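/- Let $L$ be a compact connected Lie group with Lie algebra $\mathfrak l$, and let $L^{\mathbb C}$ be its complexification, i.e. a complex Lie group containing $L$, with Lie algebra $\mathfrak l^{\mathbb C}=\mathfrak l\oplus\sqrt{-1}\,\mathfrak l$, such that $L\times\mathfrak l\to L^{\mathbb C}$, $(a,\xi)\mapsto a\,e^{\sqrt{-1}\xi}$, is a diffeomorphism. Let $L^{\mathbb C}$ act holomorphically on a finite-dimensional Hausdorff complex manifold $(X,I)$ with Kähler metric $g$ and Kähler form $\omega=g(I\cdot,\cdot)$, let $L$ act by isometries, and let $m:X\to\mathfrak l^*$ be an ($L$-equivariant) moment map for the action of $L$ on $(X,\omega)$, with the convention $d\langle m,\xi\rangle=\omega(\xi^*,\cdot)$, where $\xi^*$ is the vector field on $X$ generated by $\xi\in\mathfrak l$. Let $\zeta\in\mathfrak l^*$ be fixed by the coadjoint action of $L$. For $x\in X$ let $\alpha_{x,\zeta}$ be the $1$-form on $L\backslash L^{\mathbb C}$ given by $$(\alpha_{x,\zeta})_{Lg}(\xi_g)=\langle m(gx)-\zeta,\xi\rangle,\qquad \xi_g=\frac{d}{dt}\Big|_{t=0}Le^{\sqrt{-1}t\xi}g\quad(\xi\in\mathfrak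 l,\ g\in L^{\mathbb C}).$$ Write $\mathrm{Stab}(x)^{\mathbb C}=\{g\in L^{\mathbb C}: gx=x\}$, let $\mathrm{stab}(x)^{\mathbb C}\subset\mathfrak l^{\mathbb C}$ be its Lie algebra, and let $\widetilde{\mathrm{stab}}(x)\subset\mathfrak l$ be the image of $\mathrm{stab}(x)^{\mathbb C}$ under $a+\sqrt{-1}b\mapsto b$ $(a,b\in\mathfrak l)$. **Proposition 4.8.** For every $x\in X$ there is a unique function $\Phi_{x,\zeta}:L\backslash L^{\mathbb C}\to\mathbb R$ with $d\Phi_{x,\zeta}=\alpha_{x,\zeta}$ and $\Phi_{x,\zeta}(L\cdot 1)=0$. The function $\Phi_{x,\zeta}$ has a critical point if and only if there is some $g\in L^{\mathbb C}$ such that both of the following hold: (i) $\Phi_{gx,\zeta}$ is $\mathrm{Stab}(gx)^{\mathbb C}$-invariant, i.e. $\Phi_{gx,\zeta}(Lh\gamma)=\Phi_{gx,\zeta}(Lh)$ for all $h\in L^{\mathbb C}$ and $\gamma\in\mathrm{Stab}(gx)^{\mathbb C}$; (ii) $\lim_{t\to\infty}\Phi_{gx,\zeta}(Le^{\sqrt{-1}t\xi})=\infty$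 for every $\xi\in\mathfrak l\setminus\widetilde{\mathrm{stab}}(gx)$. -/

import Mathlib

open Set Filter Topology Manifold
open scoped ContDiff

noncomputable section

/-! ### Complex manifolds as real manifolds -/

/-- A complex manifold is, with the same charts, a real analytic manifold. -/
instance isManifold_real_of_complex {E : Type*} [NormedAddCommGroup E] [NormedSpace ℂ E]
    {M : Type*} [TopologicalSpace M] [ChartedSpace E M] [h : IsManifold 𝓘(ℂ, E) ω M] :
    IsManifold 𝓘(ℝ, E) ω M := by
  apply isManifold_of_contDiffOn
  intro e e' he he'
  have h1 := h.compatible he he'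
  rw [contDiffGroupoid, mem_groupoid_of_pregroupoid] at h1
  exact ContDiffOn.restrict_scalars ℝ h1.1

section ComplexStructure

variable {E : Type*} [NormedAddCommGroup E] [NormedSpace ℂ E]
  {M : Type*} [TopologicalSpace M] [ChartedSpace E M]

/-- Multiplication by `√-1` on the (real) tangent space of a complex manifold. -/
def tangentI (x : M) : TangentSpace 𝓘(ℝ, E) x →L[ℝ] TangentSpace 𝓘(ℝ, E) x :=
  ((Complex.I • ContinuousLinearMap.id ℂ E).restrictScalars ℝ : E →L[ℝ] E)

end ComplexStructure

/-! ### Kähler metrics -/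

section Kahler

variable {E : Type*} [NormedAddCommGroup E] [NormedSpace ℂ E]
  {X : Type*} [TopologicalSpace X] [ChartedSpace E X] [IsManifold 𝓘(ℂ, E) ω X]

/-- The form `ω(u, v) = g(√-1 u, v)` associated with a Riemannian metric `g` on a complex
manifold. -/
def fundamentalForm
    (g : Bundle.ContMDiffRiemannianMetric 𝓘(ℝ, E) ∞ E (fun x : X ↦ TangentSpace 𝓘(ℝ, E) x))
    (x : X) (u v : TangentSpace 𝓘(ℝ, E) x) : ℝ :=
  g.inner x (tangentI x u) v

/-- The expression of the fundamental form in the chart around `x₀`: its pullback under the inverse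
of the chart, evaluated at the point `y` of the chart's target on the vectors `u, v`. -/
def fundamentalFormInChart
    (g : Bundle.ContMDiffRiemannianMetric 𝓘(ℝ, E) ∞ E (fun x : X ↦ TangentSpace 𝓘(ℝ, E) x))
    (x₀ : X) (y u v : E) : ℝ :=
  fundamentalForm g ((extChartAt 𝓘(ℝ, E) x₀).symm y)
    (mfderiv 𝓘(ℝ, E) 𝓘(ℝ, E) (extChartAt 𝓘(ℝ, E) x₀).symm y u)
    (mfderiv 𝓘(ℝ, E) 𝓘(ℝ, E) (extChartAt 𝓘(ℝ, E) x₀).symm y v)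

variable (E X) in
/-- A Kähler metric on the complex manifold `X`: a smooth Riemannian metric for which `√-1` is
isometric and whose fundamental form is closed. The last field is `dω (u, v, w) = 0`, written in
charts for constant vector fields `u, v, w`. -/
structure KahlerMetric extends
    Bundle.ContMDiffRiemannianMetric 𝓘(ℝ, E) ∞ E (fun x : X ↦ TangentSpace 𝓘(ℝ, E) x) where
  hermitian : ∀ (x : X) (u v : TangentSpace 𝓘(ℝ, E) x),
    inner x (tangentI x u) (tangentI x v) = inner x u v
  closed : ∀ (x₀ : X), ∀ y ∈ (extChartAt 𝓘(ℝ, E) x₀).target, ∀ u v w : E,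
    fderiv ℝ (fun z ↦ fundamentalFormInChart toContMDiffRiemannianMetric x₀ z v w) y u
      + fderiv ℝ (fun z ↦ fundamentalFormInChart toContMDiffRiemannianMetric x₀ z w u) y v
      + fderiv ℝ (fun z ↦ fundamentalFormInChart toContMDiffRiemannianMetric x₀ z u v) y w = 0

/-- The Kähler form `ω(u, v) = g(√-1 u, v)`. -/
def KahlerMetric.form (g : KahlerMetric E X) (x : X) (u v : TangentSpace 𝓘(ℝ, E) x) : ℝ :=
  fundamentalForm g.toContMDiffRiemannianMetric x u v

end Kahler

/-! ### Exponential map and adjoint action of a Lie group -/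

section Exponential

variable {E : Type*} [NormedAddCommGroup E] [NormedSpace ℝ E]
  {G : Type*} [Group G] [TopologicalSpace G] [ChartedSpace E G]

/-- `γ : ℝ → G` is the one-parameter subgroup with initial velocity `v`. -/
def IsOneParameterSubgroup (γ : ℝ → G) (v : GroupLieAlgebra 𝓘(ℝ, E) G) : Prop :=
  (∀ s t, γ (s + t) = γ s * γ t) ∧
    HasMFDerivAt 𝓘(ℝ, ℝ) 𝓘(ℝ, E) γ 0 (ContinuousLinearMap.toSpanSingleton ℝ (v : E))

open Classical in
/-- The exponential map of a Lie group: the value at time `1` of the one-parameter subgroup with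
initial velocity `v` (which exists and is unique on a finite-dimensional Lie group; the default
value `1` is never used there). -/
def lieExp (v : GroupLieAlgebra 𝓘(ℝ, E) G) : G :=
  if h : ∃ γ : ℝ → G, IsOneParameterSubgroup γ v then h.choose 1 else 1

/-- The adjoint action `Ad_a` on the Lie algebra: the derivative at `1` of `h ↦ a h a⁻¹`. -/
def lieAd (a : G) (v : GroupLieAlgebra 𝓘(ℝ, E) G) : GroupLieAlgebra 𝓘(ℝ, E) G :=
  (mfderiv 𝓘(ℝ, E) 𝓘(ℝ, E) (fun h : G ↦ a * h * a⁻¹) 1 v : E)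

end Exponential

/-! ### Complexification of a compact Lie group -/

section Complexification

variable {EL : Type*} [NormedAddCommGroup EL] [NormedSpace ℝ EL]
  {EK : Type*} [NormedAddCommGroup EK] [NormedSpace ℂ EK]
  {L : Type*} [Group L] [TopologicalSpace L] [ChartedSpace EL L]
  {K : Type*} [Group K] [TopologicalSpace K] [ChartedSpace EK K]

/-- The homomorphism of Lie algebras induced by a smooth homomorphism of Lie groups. -/
def lieMap (ι : L →* K) (ξ : GroupLieAlgebra 𝓘(ℝ, EL) L) : GroupLieAlgebra 𝓘(ℝ, EK) K :=
  (mfderiv 𝓘(ℝ, EL) 𝓘(ℝ, EK) (ι : L → K) 1 ξ : EK)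

/-- The element `a + √-1 b` of the Lie algebra of `L^ℂ`, for `a, b` in the Lie algebra of `L`. -/
def complexLie (ι : L →* K) (a b : GroupLieAlgebra 𝓘(ℝ, EL) L) : GroupLieAlgebra 𝓘(ℝ, EK) K :=
  lieMap ι a + tangentI (1 : K) (lieMap ι b)

/-- The element `e^{√-1 ξ}` of `L^ℂ`, for `ξ` in the Lie algebra of `L`. -/
def expI (ι : L →* K) (ξ : GroupLieAlgebra 𝓘(ℝ, EL) L) : K :=
  lieExp (complexLie (EK := EK) ι 0 ξ)

/-- The homomorphism `ι : L →* K` from a compact Lie group to a complex Lie group is a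
complexification: it is smooth, the Lie algebra of `K` is `𝔩 ⊕ √-1 𝔩`, and
`(a, ξ) ↦ a e^{√-1 ξ}` is a diffeomorphism from `L × 𝔩` to `K`. -/
structure IsComplexification (ι : L →* K) : Prop where
  contMDiff : ContMDiff 𝓘(ℝ, EL) 𝓘(ℝ, EK) ∞ ι
  lieAlgebra : ∀ v : GroupLieAlgebra 𝓘(ℝ, EK) K,
    ∃! p : GroupLieAlgebra 𝓘(ℝ, EL) L × GroupLieAlgebra 𝓘(ℝ, EL) L, complexLie ι p.1 p.2 = v
  polar : ∃ D : Diffeomorph (𝓘(ℝ, EL).prod 𝓘(ℝ, EL)) 𝓘(ℝ, EK) (L × EL) K ∞,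
    ∀ (a : L) (ξ : EL), D (a, ξ) = ι a * expI (EL := EL) (EK := EK) ι ξ

/-- The homogeneous space `L \ L^ℂ` of cosets `L g`. -/
abbrev LeftQuotient (ι : L →* K) : Type _ := Quotient (QuotientGroup.rightRel ι.range)

/-- The coset `L g`. -/
def leftCoset (ι : L →* K) (g : K) : LeftQuotient ι := Quotient.mk _ g

/-- `f : L \ L^ℂ → ℝ` is differentiable: as `g ↦ L g` is a submersion, this is tested on `L^ℂ`. -/
def DifferentiableOnQuotient (ι : L →* K) (f : LeftQuotient ι → ℝ) : Prop :=
  MDifferentiable 𝓘(ℝ, EK) 𝓘(ℝ, ℝ) (fun g : K ↦ f (leftCoset ι g))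

/-- `f : L \ L^ℂ → ℝ` has a critical point: `df = 0` at some `L g`, that is (since `g ↦ L g` is a
submersion), the pullback of `f` to `L^ℂ` has vanishing differential at `g`. -/
def HasCriticalPoint (ι : L →* K) (f : LeftQuotient ι → ℝ) : Prop :=
  ∃ g : K, HasMFDerivAt 𝓘(ℝ, EK) 𝓘(ℝ, ℝ) (fun h : K ↦ f (leftCoset ι h)) g
    (0 : EK →L[ℝ] ℝ)

end Complexification

/-! ### Hamiltonian actions and the functions `Φ_{x,ζ}` -/

section Hamiltonian

variable {EL : Type*} [NormedAddCommGroup EL] [NormedSpace ℝ EL]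
  {EK : Type*} [NormedAddCommGroup EK] [NormedSpace ℂ EK]
  {EX : Type*} [NormedAddCommGroup EX] [NormedSpace ℂ EX]
  {L : Type*} [Group L] [TopologicalSpace L] [ChartedSpace EL L]
  {K : Type*} [Group K] [TopologicalSpace K] [ChartedSpace EK K]
  {X : Type*} [TopologicalSpace X] [ChartedSpace EX X] [MulAction K X]

/-- The value at `x` of the vector field on `X` generated by `ξ` in the Lie algebra of `L`:
the derivative at `1` of `a ↦ a x`. -/
def fundamentalVector (ι : L →* K) (ξ : GroupLieAlgebra 𝓘(ℝ, EL) L) (x : X) :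
    TangentSpace 𝓘(ℝ, EX) x :=
  (mfderiv 𝓘(ℝ, EL) 𝓘(ℝ, EX) (fun a : L ↦ ι a • x) 1 ξ : EX)

/-- `L` acts by isometries of the Kähler metric. -/
def ActsIsometrically [IsManifold 𝓘(ℂ, EX) ω X] (ι : L →* K) (g : KahlerMetric EX X) : Prop :=
  ∀ (a : L) (x : X) (u v : TangentSpace 𝓘(ℝ, EX) x),
    g.inner (ι a • x) (mfderiv 𝓘(ℝ, EX) 𝓘(ℝ, EX) (fun y : X ↦ ι a • y) x u)
      (mfderiv 𝓘(ℝ, EX) 𝓘(ℝ, EX) (fun y : X ↦ ι a • y) x v) = g.inner x u v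

/-- `m : X → 𝔩^*` is a moment map for the action of `L` on `(X, ω)`: it is smooth,
`d⟨m, ξ⟩ = ω(ξ^*, ·)` for the vector field `ξ^*` generated by `ξ`, and it is equivariant for the
coadjoint action, `⟨m (a x), ξ⟩ = ⟨m x, Ad_{a⁻¹} ξ⟩`. -/
structure IsMomentMap [IsManifold 𝓘(ℂ, EX) ω X] (ι : L →* K) (g : KahlerMetric EX X)
    (m : X → Module.Dual ℝ (GroupLieAlgebra 𝓘(ℝ, EL) L)) : Prop where
  contMDiff : ∀ ξ, ContMDiff 𝓘(ℝ, EX) 𝓘(ℝ, ℝ) ∞ (fun x ↦ m x ξ)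
  hamiltonian : ∀ ξ (x : X) (v : TangentSpace 𝓘(ℝ, EX) x),
    (mfderiv 𝓘(ℝ, EX) 𝓘(ℝ, ℝ) (fun y ↦ m y ξ) x v : ℝ) = g.form x (fundamentalVector ι ξ x) v
  equivariant : ∀ (a : L) (x : X) ξ, m (ι a • x) ξ = m x (lieAd a⁻¹ ξ)

/-- `Φ` is a primitive of the `1`-form `α_{x,ζ}` on `L \ L^ℂ`, normalized by `Φ (L 1) = 0`. Here
`α_{x,ζ}` is given at `L g` by `ξ_g ↦ ⟨m (g x) - ζ, ξ⟩`, where `ξ_g` is the velocity at `t = 0` of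
the curve `L e^{√-1 t ξ} g`; the vectors `ξ_g` exhaust the tangent space at `L g`. -/
structure IsNormalizedPrimitive (ι : L →* K)
    (m : X → Module.Dual ℝ (GroupLieAlgebra 𝓘(ℝ, EL) L))
    (ζ : Module.Dual ℝ (GroupLieAlgebra 𝓘(ℝ, EL) L)) (x : X)
    (Φ : LeftQuotient ι → ℝ) : Prop where
  differentiable : DifferentiableOnQuotient (EK := EK) ι Φ
  deriv_eq : ∀ (g : K) (ξ : GroupLieAlgebra 𝓘(ℝ, EL) L),
    HasDerivAt (fun t : ℝ ↦ Φ (leftCoset ι (expI (EK := EK) ι (t • ξ) * g)))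
      ((m (g • x) - ζ) ξ) 0
  normalized : Φ (leftCoset ι 1) = 0

variable (EK) in
/-- The function `Φ_{x,ζ} : L \ L^ℂ → ℝ`, the normalized primitive of `α_{x,ζ}`. -/
def potential (ι : L →* K) (m : X → Module.Dual ℝ (GroupLieAlgebra 𝓘(ℝ, EL) L))
    (ζ : Module.Dual ℝ (GroupLieAlgebra 𝓘(ℝ, EL) L)) (x : X) : LeftQuotient ι → ℝ :=
  Classical.epsilon (IsNormalizedPrimitive (EK := EK) ι m ζ x)

variable (EK K) in
/-- The Lie algebra of the closed subgroup `Stab(x)^ℂ = {g ∈ L^ℂ | g x = x}` of `L^ℂ`. -/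
def stabLie (x : X) : Set (GroupLieAlgebra 𝓘(ℝ, EK) K) :=
  {v | ∀ t : ℝ, lieExp (t • v) ∈ MulAction.stabilizer K x}

variable (EL EK) in
/-- The image of the Lie algebra of `Stab(x)^ℂ` under `a + √-1 b ↦ b`. -/
def stabIm (ι : L →* K) (x : X) : Set (GroupLieAlgebra 𝓘(ℝ, EL) L) :=
  {b | ∃ a : GroupLieAlgebra 𝓘(ℝ, EL) L, complexLie (EK := EK) ι a b ∈ stabLie EK K x}

end Hamiltonian

end

set_option linter.unusedSectionVars false

/-! Write i for √-1, K for L^ℂ and N(ξ) = m(e^{iξ}x) - ζ. The polar decomposition gives a coordinate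
ξ ↦ L e^{iξ} on L\K, and the candidate for Φ_x is the integral R of α along the rays s ↦ L e^{isξ}.
That dR agrees with α on all tangent vectors, not only radial ones, is the closedness of α. It comes
down to one s-derivative (`IsMomentMap.hasDerivAt_momentPolar_im`), computed from the symmetry of
g(ξ*, η*), the equivariance of m, the invariance of ζ, and the right logarithmic derivative of ξ ↦
e^{iξ}. A primitive is determined by its derivatives along rays, which gives uniqueness and also the
cocycle rule Φ_x(hk) = Φ_{kx}(h) + Φ_x(k). Along t ↦ L e^{itξ} the second derivative of Φ_x is
|ξ*|², so Φ_x is convex there.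

If Lk is critical, then m(y) = ζ for y = kx. Convexity gives Φ_y ≥ 0. For γ in the stabilizer of y
the cocycle rule gives Φ_y(γ) + Φ_y(γ⁻¹) = 0, so both terms vanish and Φ_y is γ-invariant. If ξ*
does not vanish at y, the slope along e^{itξ} becomes positive and convexity forces at least linear
growth.

Conversely, let y = kx satisfy (i) and (ii), and suppose that R (for y) has no minimum. Fix an
Ad-invariant scalar product q on 𝔩, and take minimizers ξ_n of R over growing q-balls, each of least
length in its level set. They escape to infinity, and a limit direction u satisfies R ≤ 0 on its ray
by convexity, so (ii) puts u in the image of stab(y)^ℂ: some a + iu generates a subgroup fixing y.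
By (i), right translation of L e^{iξ_n} by this subgroup stays in the level set, so the length is
stationary along it, and the Gauss lemma (`IsInvariantForm.hasDerivAt_polarLog_sq`) gives q(ξ_n, u)
= 0. In the limit q(u, u) = 0, a contradiction. A minimum of R is a critical point of Φ_y, hence by
the cocycle rule yields one of Φ_x. -/

noncomputable section

/-! ### Manifold derivatives as linear maps between model spaces. -/

section ModelDeriv

variable {𝕜 : Type*} [NontriviallyNormedField 𝕜]
  {E : Type*} [NormedAddCommGroup E] [NormedSpace 𝕜 E]
  {E' : Type*} [NormedAddCommGroup E'] [NormedSpace 𝕜 E']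
  {E'' : Type*} [NormedAddCommGroup E''] [NormedSpace 𝕜 E'']
  {M : Type*} [TopologicalSpace M] [ChartedSpace E M]
  {M' : Type*} [TopologicalSpace M'] [ChartedSpace E' M']
  {M'' : Type*} [TopologicalSpace M''] [ChartedSpace E'' M'']

variable (𝕜) in
/-- `HasMFDerivAt` for manifolds modelled on normed spaces, where the derivative is given as a
linear map between the model spaces. -/
def HasModelDerivAt (f : M → M') (x : M) (f' : E →L[𝕜] E') : Prop :=
  HasMFDerivAt 𝓘(𝕜, E) 𝓘(𝕜, E') f x f'

variable (𝕜 E E') in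
/-- `mfderiv` as a linear map between the model spaces. -/
def modelDeriv (f : M → M') (x : M) : E →L[𝕜] E' :=
  mfderiv 𝓘(𝕜, E) 𝓘(𝕜, E') f x

theorem MDifferentiableAt.hasModelDerivAt {f : M → M'} {x : M}
    (h : MDifferentiableAt 𝓘(𝕜, E) 𝓘(𝕜, E') f x) :
    HasModelDerivAt 𝕜 f x (modelDeriv 𝕜 E E' f x) :=
  h.hasMFDerivAt

theorem HasModelDerivAt.modelDeriv_eq {f : M → M'} {x : M} {f' : E →L[𝕜] E'}
    (h : HasModelDerivAt 𝕜 f x f') : modelDeriv 𝕜 E E' f x = f' :=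
  HasMFDerivAt.mfderiv h

theorem HasModelDerivAt.mdifferentiableAt {f : M → M'} {x : M} {f' : E →L[𝕜] E'}
    (h : HasModelDerivAt 𝕜 f x f') : MDifferentiableAt 𝓘(𝕜, E) 𝓘(𝕜, E') f x :=
  HasMFDerivAt.mdifferentiableAt h

theorem HasModelDerivAt.unique {f : M → M'} {x : M} {f₁ f₂ : E →L[𝕜] E'}
    (h₁ : HasModelDerivAt 𝕜 f x f₁) (h₂ : HasModelDerivAt 𝕜 f x f₂) : f₁ = f₂ :=
  h₁.modelDeriv_eq.symm.trans h₂.modelDeriv_eq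

theorem HasModelDerivAt.comp {g : M' → M''} {f : M → M'} {x : M} {y : M'}
    {g' : E' →L[𝕜] E''} {f' : E →L[𝕜] E'}
    (hg : HasModelDerivAt 𝕜 g y g') (hf : HasModelDerivAt 𝕜 f x f') (hy : f x = y) :
    HasModelDerivAt 𝕜 (fun z ↦ g (f z)) x (g'.comp f') := by
  subst hy
  exact HasMFDerivAt.comp x hg hf

theorem HasModelDerivAt.congr {f g : M → M'} {x : M} {f' : E →L[𝕜] E'}
    (h : HasModelDerivAt 𝕜 f x f') (hfg : ∀ᶠ z in 𝓝 x, g z = f z) : HasModelDerivAt 𝕜 g x f' :=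
  HasMFDerivAt.congr_of_eventuallyEq h hfg

theorem hasModelDerivAt_const (c : M') (x : M) :
    HasModelDerivAt 𝕜 (fun _ : M ↦ c) x (0 : E →L[𝕜] E') :=
  hasMFDerivAt_const c x

theorem hasModelDerivAt_id (x : M) :
    HasModelDerivAt 𝕜 (fun z : M ↦ z) x (ContinuousLinearMap.id 𝕜 E) :=
  hasMFDerivAt_id x

theorem hasModelDerivAt_iff_hasFDerivAt {f : E → E'} {x : E} {f' : E →L[𝕜] E'} :
    HasModelDerivAt 𝕜 f x f' ↔ HasFDerivAt f f' x :=
  hasMFDerivAt_iff_hasFDerivAt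

/-- The derivative of a map from a normed space, read in the chart around the image point. -/
theorem hasModelDerivAt_iff_extChartAt {f : E → M'} {x : E} {f' : E →L[𝕜] E'} :
    HasModelDerivAt 𝕜 f x f' ↔
      ContinuousAt f x ∧ HasFDerivAt (fun z ↦ extChartAt 𝓘(𝕜, E') (f x) (f z)) f' x := by
  rw [← hasFDerivWithinAt_univ]
  unfold HasModelDerivAt HasMFDerivAt
  simp only [writtenInExtChartAt, mfld_simps, Function.comp_def, chartAt_self_eq]
  rfl

theorem HasModelDerivAt.comp_deriv {f : M → M'} {x : M} {f' : E →L[𝕜] E'}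
    {γ : 𝕜 → M} {t : 𝕜} {v : E} (hf : HasModelDerivAt 𝕜 f x f')
    (hγ : HasModelDerivAt 𝕜 γ t (ContinuousLinearMap.toSpanSingleton 𝕜 v)) (hx : γ t = x) :
    HasModelDerivAt 𝕜 (fun s ↦ f (γ s)) t (ContinuousLinearMap.toSpanSingleton 𝕜 (f' v)) := by
  have := hf.comp hγ hx
  convert! this using 1
  ext
  simp

theorem hasModelDerivAt_toSpanSingleton {f : 𝕜 → E} {t : 𝕜} {v : E} :
    HasModelDerivAt 𝕜 f t (ContinuousLinearMap.toSpanSingleton 𝕜 v) ↔ HasDerivAt f v t :=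
  hasModelDerivAt_iff_hasFDerivAt

end ModelDeriv

/-! ### From holomorphic to real smooth maps. -/

section RestrictScalars

variable {E : Type*} [NormedAddCommGroup E] [NormedSpace ℂ E]
  {E₁ : Type*} [NormedAddCommGroup E₁] [NormedSpace ℂ E₁]
  {E' : Type*} [NormedAddCommGroup E'] [NormedSpace ℂ E']
  {M : Type*} [TopologicalSpace M] [ChartedSpace E M]
  {M₁ : Type*} [TopologicalSpace M₁] [ChartedSpace E₁ M₁]
  {M' : Type*} [TopologicalSpace M'] [ChartedSpace E' M']

theorem HasModelDerivAt.restrictScalars_real {f : M → M'} {x : M} {f' : E →L[ℂ] E'}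
    (h : HasModelDerivAt ℂ f x f') : HasModelDerivAt ℝ f x (f'.restrictScalars ℝ) := by
  refine ⟨h.1, ?_⟩
  have := HasFDerivWithinAt.restrictScalars ℝ h.2
  exact this

theorem ContMDiff.restrictScalars_real {n : WithTop ℕ∞} {f : M → M'}
    (h : ContMDiff 𝓘(ℂ, E) 𝓘(ℂ, E') n f) : ContMDiff 𝓘(ℝ, E) 𝓘(ℝ, E') n f := by
  intro x
  have hx := contMDiffAt_iff.1 (h x)
  exact contMDiffAt_iff.2 ⟨hx.1, ContDiffWithinAt.restrict_scalars ℝ hx.2⟩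

theorem ContMDiff.restrictScalars_real_prod {n : WithTop ℕ∞} {f : M × M₁ → M'}
    (h : ContMDiff (𝓘(ℂ, E).prod 𝓘(ℂ, E₁)) 𝓘(ℂ, E') n f) :
    ContMDiff (𝓘(ℝ, E).prod 𝓘(ℝ, E₁)) 𝓘(ℝ, E') n f := by
  intro x
  have hx := contMDiffAt_iff.1 (h x)
  exact contMDiffAt_iff.2 ⟨hx.1, ContDiffWithinAt.restrict_scalars ℝ hx.2⟩

/-- A complex Lie group is a real Lie group. -/
instance LieGroup.real_of_complex {G : Type*} [Group G] [TopologicalSpace G] [ChartedSpace E G]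
    [h : LieGroup 𝓘(ℂ, E) ω G] : LieGroup 𝓘(ℝ, E) ω G where
  toIsManifold := isManifold_real_of_complex
  contMDiff_mul := (contMDiff_mul 𝓘(ℂ, E) ω).restrictScalars_real_prod
  contMDiff_inv := (ContMDiff.restrictScalars_real (h.contMDiff_inv))

end RestrictScalars

/-! ### Multiplication at the identity and the adjoint action. -/

section LieGroupDeriv

variable {𝕜 : Type*} [NontriviallyNormedField 𝕜]
  {E : Type*} [NormedAddCommGroup E] [NormedSpace 𝕜 E]
  {E' : Type*} [NormedAddCommGroup E'] [NormedSpace 𝕜 E']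
  {F : Type*} [NormedAddCommGroup F] [NormedSpace 𝕜 F]
  {G : Type*} [Group G] [TopologicalSpace G] [ChartedSpace E G] [LieGroup 𝓘(𝕜, E) ∞ G]
  {M : Type*} [TopologicalSpace M] [ChartedSpace E' M]

theorem hasModelDerivAt_mul_one_one :
    HasMFDerivAt (𝓘(𝕜, E).prod 𝓘(𝕜, E)) 𝓘(𝕜, E) (fun p : G × G ↦ p.1 * p.2) (1, 1)
      (ContinuousLinearMap.fst 𝕜 E E + ContinuousLinearMap.snd 𝕜 E E : E × E →L[𝕜] E) := by
  have hd : MDifferentiableAt (𝓘(𝕜, E).prod 𝓘(𝕜, E)) 𝓘(𝕜, E) (fun p : G × G ↦ p.1 * p.2) (1, 1) :=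
    (contMDiff_mul 𝓘(𝕜, E) ∞).mdifferentiable (by simp) _
  have h1 : modelDeriv 𝕜 E E (fun z : G ↦ z * 1) 1 = ContinuousLinearMap.id 𝕜 E := by
    simpa only [mul_one] using (hasModelDerivAt_id (1 : G)).modelDeriv_eq
  have h2 : modelDeriv 𝕜 E E (fun z : G ↦ 1 * z) 1 = ContinuousLinearMap.id 𝕜 E := by
    simpa only [one_mul] using (hasModelDerivAt_id (1 : G)).modelDeriv_eq
  have h3 : (mfderiv (𝓘(𝕜, E).prod 𝓘(𝕜, E)) 𝓘(𝕜, E) (fun p : G × G ↦ p.1 * p.2) (1, 1) :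
      E × E →L[𝕜] E) = ContinuousLinearMap.fst 𝕜 E E + ContinuousLinearMap.snd 𝕜 E E := by
    refine ContinuousLinearMap.ext fun v ↦ ?_
    refine (mfderiv_prod_eq_add_apply (v := v) hd).trans ?_
    change modelDeriv 𝕜 E E (fun z : G ↦ z * 1) 1 v.1
      + modelDeriv 𝕜 E E (fun z : G ↦ 1 * z) 1 v.2 = _
    rw [h1, h2]
    rfl
  rw [← h3]
  exact hd.hasMFDerivAt

/-- The product rule is needed only where both factors equal 1: elsewhere a curve k is replaced by s
↦ k(s) k(t)⁻¹, whose derivative at t is the right logarithmic derivative. No translated tangent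
spaces then occur. -/
theorem HasModelDerivAt.mul_of_eq_one {f g : M → G} {x : M} {f' g' : E' →L[𝕜] E}
    (hf : HasModelDerivAt 𝕜 f x f') (hg : HasModelDerivAt 𝕜 g x g') (hfx : f x = 1)
    (hgx : g x = 1) : HasModelDerivAt 𝕜 (fun z ↦ f z * g z) x (f' + g') := by
  have h1 : HasMFDerivAt (𝓘(𝕜, E).prod 𝓘(𝕜, E)) 𝓘(𝕜, E) (fun p : G × G ↦ p.1 * p.2) (f x, g x)
      (ContinuousLinearMap.fst 𝕜 E E + ContinuousLinearMap.snd 𝕜 E E : E × E →L[𝕜] E) := by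
    rw [hfx, hgx]; exact hasModelDerivAt_mul_one_one
  have := HasMFDerivAt.comp x h1 (HasMFDerivAt.prodMk hf hg)
  exact this

theorem hasModelDerivAt_mul_left (a b : G) :
    HasModelDerivAt 𝕜 (fun h : G ↦ a * h) b (modelDeriv 𝕜 E E (fun h : G ↦ a * h) b) :=
  ((contMDiff_mul_left (I := 𝓘(𝕜, E)) (n := ∞)).mdifferentiable (by simp) b).hasModelDerivAt

theorem hasModelDerivAt_mul_right (a b : G) :
    HasModelDerivAt 𝕜 (fun h : G ↦ h * a) b (modelDeriv 𝕜 E E (fun h : G ↦ h * a) b) :=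
  ((contMDiff_mul_right (I := 𝓘(𝕜, E)) (n := ∞)).mdifferentiable (by simp) b).hasModelDerivAt

variable (𝕜 E) in
/-- The adjoint action of a Lie group on its Lie algebra. -/
def lieGroupAd (k : G) : E →L[𝕜] E := modelDeriv 𝕜 E E (fun h : G ↦ k * h * k⁻¹) 1

theorem hasModelDerivAt_conj (k : G) :
    HasModelDerivAt 𝕜 (fun h : G ↦ k * h * k⁻¹) 1 (lieGroupAd 𝕜 E k) := by
  refine MDifferentiableAt.hasModelDerivAt ?_
  exact (((contMDiff_mul_right (I := 𝓘(𝕜, E)) (n := ∞) (a := k⁻¹)).comp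
    (contMDiff_mul_left (I := 𝓘(𝕜, E)) (n := ∞) (a := k))).mdifferentiable (by simp) 1)

theorem lieGroupAd_mul (k l : G) (v : E) :
    lieGroupAd 𝕜 E (k * l) v = lieGroupAd 𝕜 E k (lieGroupAd 𝕜 E l v) := by
  have h := (hasModelDerivAt_conj (𝕜 := 𝕜) (E := E) k).comp (hasModelDerivAt_conj (𝕜 := 𝕜) (E := E) l) (by simp)
  have h' := hasModelDerivAt_conj (𝕜 := 𝕜) (E := E) (k * l)
  simp only [mul_inv_rev, mul_assoc] at h h'
  rw [h'.unique h]
  rfl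

theorem lieGroupAd_one (v : E) : lieGroupAd 𝕜 E (1 : G) v = v := by
  have h := hasModelDerivAt_conj (𝕜 := 𝕜) (E := E) (1 : G)
  simp only [inv_one, mul_one, one_mul] at h
  rw [h.unique (hasModelDerivAt_id _)]
  rfl

/-- The derivative of a family of maps into a manifold, along points with a common image. -/
theorem contDiffAt_modelDeriv_param {F' : Type*} [NormedAddCommGroup F'] [NormedSpace 𝕜 F']
    {f : F → F' → M} {g : F → F'} {a : F} {c : M} [IsManifold 𝓘(𝕜, E') ∞ M]
    (hf : ContMDiffAt 𝓘(𝕜, F × F') 𝓘(𝕜, E') ∞ (Function.uncurry f) (a, g a))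
    (hg : ContDiffAt 𝕜 ∞ g a) (hc : ∀ᶠ z in 𝓝 a, f z (g z) = c) :
    ContDiffAt 𝕜 ∞ (fun z ↦ modelDeriv 𝕜 F' E' (f z) (g z)) a := by
  have hca : f a (g a) = c := hc.self_of_nhds
  -- Because f z (g z) = c for all nearby z, the single chart around c computes every one of these
  -- derivatives, and the claim reduces to smoothness of `fderiv` of a vector-valued family.
  have h1 : ContDiffAt 𝕜 ∞ (Function.uncurry fun z u ↦ extChartAt 𝓘(𝕜, E') c (f z u))
      (a, g a) := by
    have h2 := (contMDiffAt_iff_target.1 hf).2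
    rw [contMDiffAt_iff_contDiffAt] at h2
    simp only [Function.uncurry, hca] at h2
    exact h2
  have h3 := ContDiffAt.fderiv h1 hg (m := ∞) (by simp)
  refine h3.congr_of_eventuallyEq ?_
  have hf1 : ∀ᶠ p in 𝓝 (a, g a), ContMDiffAt 𝓘(𝕜, F × F') 𝓘(𝕜, E') 1 (Function.uncurry f) p :=
    (contMDiffAt_iff_contMDiffAt_nhds (by simp)).1 (hf.of_le (m := 1) (by simp))
  have hf2 := (continuousAt_id.prodMk hg.continuousAt).eventually hf1
  filter_upwards [hc, hf2] with z hz hz2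
  have hd : MDifferentiableAt 𝓘(𝕜, F') 𝓘(𝕜, E') (f z) (g z) := by
    have h5 : ContMDiffAt 𝓘(𝕜, F') 𝓘(𝕜, E') 1 (fun u ↦ Function.uncurry f (z, u)) (g z) :=
      ContMDiffAt.comp (I' := 𝓘(𝕜, F × F')) (g z) hz2
        ((contDiffAt_const.prodMk contDiffAt_id).contMDiffAt)
    exact h5.mdifferentiableAt (by simp)
  have h6 := (hasModelDerivAt_iff_extChartAt.1 hd.hasModelDerivAt).2.fderiv
  rw [hz] at h6
  exact h6.symm

/-- `k ↦ Ad_k v` is differentiable at `1`. -/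
theorem mdifferentiableAt_lieGroupAd (v : E) :
    MDifferentiableAt 𝓘(𝕜, E) 𝓘(𝕜, E) (fun k : G ↦ lieGroupAd 𝕜 E k v) 1 := by
  have hs : ContMDiffAt 𝓘(𝕜, E) 𝓘(𝕜, E) ∞ (extChartAt 𝓘(𝕜, E) (1 : G)).symm
      (extChartAt 𝓘(𝕜, E) (1 : G) 1) :=
    (contMDiffOn_extChartAt_symm (1 : G)).contMDiffAt (extChartAt_target_mem_nhds 1)
  have hd1 : HasModelDerivAt 𝕜 (extChartAt 𝓘(𝕜, E) (1 : G)).symm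
      (extChartAt 𝓘(𝕜, E) (1 : G) 1) (ContinuousLinearMap.id 𝕜 E) := by
    refine hasModelDerivAt_iff_extChartAt.2 ⟨hs.continuousAt, ?_⟩
    refine (hasFDerivAt_id _).congr_of_eventuallyEq ?_
    filter_upwards [extChartAt_target_mem_nhds (I := 𝓘(𝕜, E)) (1 : G)] with z hz
    rw [extChartAt_to_inv]
    exact (extChartAt 𝓘(𝕜, E) (1 : G)).right_inv hz
  -- Both k and h are parametrized by the inverse chart, whose derivative at the image of 1 is the
  -- identity (`hd1`), so the derivative in the second variable is Ad_k itself.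
  have h1 := contDiffAt_modelDeriv_param (𝕜 := 𝕜) (F := E) (F' := E) (E' := E) (M := G) (c := 1)
    (f := fun z u ↦ (extChartAt 𝓘(𝕜, E) (1 : G)).symm z * (extChartAt 𝓘(𝕜, E) (1 : G)).symm u
      * ((extChartAt 𝓘(𝕜, E) (1 : G)).symm z)⁻¹)
    (g := fun _ ↦ extChartAt 𝓘(𝕜, E) (1 : G) 1) (a := extChartAt 𝓘(𝕜, E) (1 : G) 1) ?_
    contDiffAt_const (by simp)
  · have h2 : ∀ z, modelDeriv 𝕜 E E
        (fun u ↦ (extChartAt 𝓘(𝕜, E) (1 : G)).symm z * (extChartAt 𝓘(𝕜, E) (1 : G)).symm u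
          * ((extChartAt 𝓘(𝕜, E) (1 : G)).symm z)⁻¹) (extChartAt 𝓘(𝕜, E) (1 : G) 1)
        = lieGroupAd 𝕜 E ((extChartAt 𝓘(𝕜, E) (1 : G)).symm z) := by
      intro z
      refine ((hasModelDerivAt_conj _).comp hd1 (by simp)).modelDeriv_eq.trans ?_
      simp
    simp only [h2] at h1
    have h3 : MDifferentiableAt 𝓘(𝕜, E) 𝓘(𝕜, E)
        (fun z ↦ lieGroupAd 𝕜 E ((extChartAt 𝓘(𝕜, E) (1 : G)).symm z) v)
        (extChartAt 𝓘(𝕜, E) (1 : G) 1) :=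
      ((h1.clm_apply contDiffAt_const).differentiableAt (by simp)).mdifferentiableAt
    have h4 := h3.comp (1 : G) (mdifferentiableAt_extChartAt (mem_chart_source E (1 : G)))
    refine h4.congr_of_eventuallyEq ?_
    filter_upwards [extChartAt_source_mem_nhds (I := 𝓘(𝕜, E)) (1 : G)] with k hk
    simp only [Function.comp_apply, (extChartAt 𝓘(𝕜, E) (1 : G)).left_inv hk]
  · have hA : ContMDiffAt 𝓘(𝕜, E × E) 𝓘(𝕜, E) ∞
        (fun p : E × E ↦ (extChartAt 𝓘(𝕜, E) (1 : G)).symm p.1)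
        (extChartAt 𝓘(𝕜, E) (1 : G) 1, extChartAt 𝓘(𝕜, E) (1 : G) 1) :=
      ContMDiffAt.comp (I' := 𝓘(𝕜, E)) _ hs contDiffAt_fst.contMDiffAt
    have hB : ContMDiffAt 𝓘(𝕜, E × E) 𝓘(𝕜, E) ∞
        (fun p : E × E ↦ (extChartAt 𝓘(𝕜, E) (1 : G)).symm p.2)
        (extChartAt 𝓘(𝕜, E) (1 : G) 1, extChartAt 𝓘(𝕜, E) (1 : G) 1) :=
      ContMDiffAt.comp (I' := 𝓘(𝕜, E)) _ hs contDiffAt_snd.contMDiffAt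
    exact (hA.mul hB).mul hA.inv

end LieGroupDeriv

/-! ### One-parameter subgroups and the exponential map. -/

section OneParameterSubgroup

variable {E : Type*} [NormedAddCommGroup E] [NormedSpace ℝ E]
  {G : Type*} [Group G] [TopologicalSpace G] [ChartedSpace E G]

theorem IsOneParameterSubgroup.map_zero {γ : ℝ → G} {v : E}
    (h : IsOneParameterSubgroup (E := E) γ v) : γ 0 = 1 := by
  have := h.1 0 0
  simpa using this

theorem IsOneParameterSubgroup.hasModelDerivAt {γ : ℝ → G} {v : E}
    (h : IsOneParameterSubgroup (E := E) γ v) :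
    HasModelDerivAt ℝ γ 0 (ContinuousLinearMap.toSpanSingleton ℝ v) := h.2

theorem isMIntegralCurve_iff_hasModelDerivAt {M : Type*} [TopologicalSpace M] [ChartedSpace E M]
    {γ : ℝ → M} {X : M → E} {t : ℝ} :
    HasMFDerivAt 𝓘(ℝ, ℝ) 𝓘(ℝ, E) γ t ((1 : ℝ →L[ℝ] ℝ).smulRight (X (γ t)) : ℝ →L[ℝ] E) ↔
    HasModelDerivAt ℝ γ t (ContinuousLinearMap.toSpanSingleton ℝ (X (γ t))) := by
  have : ((1 : ℝ →L[ℝ] ℝ).smulRight (X (γ t)) : ℝ →L[ℝ] E)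
      = ContinuousLinearMap.toSpanSingleton ℝ (X (γ t)) := by
    ext; simp
  rw [this]
  rfl

theorem hasModelDerivAt_comp_mul {M : Type*} [TopologicalSpace M] [ChartedSpace E M]
    {γ : ℝ → M} {v : E} {c t : ℝ}
    (h : HasModelDerivAt ℝ γ (c * t) (ContinuousLinearMap.toSpanSingleton ℝ v)) :
    HasModelDerivAt ℝ (fun s ↦ γ (c * s)) t (ContinuousLinearMap.toSpanSingleton ℝ (c • v)) := by
  have h1 : HasModelDerivAt ℝ (fun s : ℝ ↦ c * s) t (ContinuousLinearMap.toSpanSingleton ℝ c) :=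
    hasModelDerivAt_toSpanSingleton.2 (by simpa using (hasDerivAt_id t).const_mul c)
  simpa using h.comp_deriv h1 rfl

theorem hasModelDerivAt_comp_add {M : Type*} [TopologicalSpace M] [ChartedSpace E M]
    {γ : ℝ → M} {v : E} {c t : ℝ}
    (h : HasModelDerivAt ℝ γ (t + c) (ContinuousLinearMap.toSpanSingleton ℝ v)) :
    HasModelDerivAt ℝ (fun s ↦ γ (s + c)) t (ContinuousLinearMap.toSpanSingleton ℝ v) := by
  have h1 : HasModelDerivAt ℝ (fun s : ℝ ↦ s + c) t (ContinuousLinearMap.toSpanSingleton ℝ (1 : ℝ)) :=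
    hasModelDerivAt_toSpanSingleton.2 ((hasDerivAt_id t).add_const c)
  simpa using h.comp_deriv h1 rfl

theorem IsOneParameterSubgroup.comp_mul {γ : ℝ → G} {v : E}
    (h : IsOneParameterSubgroup (E := E) γ v) (c : ℝ) :
    IsOneParameterSubgroup (E := E) (fun t ↦ γ (c * t)) (c • v : E) := by
  refine ⟨fun s t ↦ by simp only [mul_add, h.1], ?_⟩
  apply hasModelDerivAt_comp_mul
  rw [mul_zero]
  exact h.hasModelDerivAt

/-- The right logarithmic derivative of a one-parameter subgroup. -/
theorem IsOneParameterSubgroup.hasModelDerivAt_mul_inv {γ : ℝ → G} {v : E}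
    (h : IsOneParameterSubgroup (E := E) γ v) (t : ℝ) :
    HasModelDerivAt ℝ (fun s ↦ γ s * (γ t)⁻¹) t (ContinuousLinearMap.toSpanSingleton ℝ v) := by
  have h1 : HasModelDerivAt ℝ (fun s ↦ γ (s + -t)) t
      (ContinuousLinearMap.toSpanSingleton ℝ v) := by
    apply hasModelDerivAt_comp_add
    rw [add_neg_cancel]
    exact h.hasModelDerivAt
  refine h1.congr (Eventually.of_forall fun s ↦ ?_)
  have h2 := h.1 (s + -t) t
  rw [neg_add_cancel_right] at h2
  rw [h2]; group

variable [LieGroup 𝓘(ℝ, E) ∞ G]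

theorem modelDeriv_mul_left_mul (a b : G) (v : E) :
    modelDeriv ℝ E E (fun h : G ↦ a * h) b (modelDeriv ℝ E E (fun h : G ↦ b * h) 1 v)
      = modelDeriv ℝ E E (fun h : G ↦ (a * b) * h) 1 v := by
  have h := (hasModelDerivAt_mul_left (𝕜 := ℝ) (E := E) a b).comp
    (hasModelDerivAt_mul_left (𝕜 := ℝ) (E := E) b 1) (by simp)
  simp only [← mul_assoc] at h
  rw [h.modelDeriv_eq]
  rfl

theorem IsOneParameterSubgroup.hasModelDerivAt_left {γ : ℝ → G} {v : E}
    (h : IsOneParameterSubgroup (E := E) γ v) (t : ℝ) :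
    HasModelDerivAt ℝ γ t (ContinuousLinearMap.toSpanSingleton ℝ
      (modelDeriv ℝ E E (fun h : G ↦ γ t * h) 1 v)) := by
  have h1 : HasModelDerivAt ℝ (fun s ↦ γ (s + -t)) t
      (ContinuousLinearMap.toSpanSingleton ℝ v) := by
    apply hasModelDerivAt_comp_add
    rw [add_neg_cancel]
    exact h.hasModelDerivAt
  have h2 := (hasModelDerivAt_mul_left (𝕜 := ℝ) (E := E) (γ t) 1).comp_deriv h1
    (by rw [add_neg_cancel]; exact h.map_zero)
  refine h2.congr (Eventually.of_forall fun s ↦ ?_)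
  rw [← h.1]
  congr 1; ring

theorem contMDiff_mulInvariantVectorField_one (v : E) :
    ContMDiff 𝓘(ℝ, E) 𝓘(ℝ, E).tangent 1
      (fun g : G ↦ (⟨g, mulInvariantVectorField (I := 𝓘(ℝ, E)) (G := G) v g⟩ :
        TangentBundle 𝓘(ℝ, E) G)) := by
  have : LieGroup 𝓘(ℝ, E) (minSmoothness ℝ 3) G := by
    rw [minSmoothness_of_isRCLikeNormedField]; infer_instance
  have h := contMDiff_mulInvariantVectorField (I := 𝓘(ℝ, E)) (G := G) v
  exact h.of_le (by rw [minSmoothness_of_isRCLikeNormedField]; norm_num)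

theorem IsOneParameterSubgroup.isMIntegralCurve {γ : ℝ → G} {v : E}
    (h : IsOneParameterSubgroup (E := E) γ v) :
    IsMIntegralCurve (I := 𝓘(ℝ, E)) γ (mulInvariantVectorField (I := 𝓘(ℝ, E)) (G := G) v) :=
  fun t ↦ (isMIntegralCurve_iff_hasModelDerivAt (E := E)
    (X := mulInvariantVectorField (I := 𝓘(ℝ, E)) (G := G) v)).2 (h.hasModelDerivAt_left t)

theorem IsOneParameterSubgroup.unique [T2Space G] [CompleteSpace E] {γ γ' : ℝ → G} {v : E}
    (h : IsOneParameterSubgroup (E := E) γ v) (h' : IsOneParameterSubgroup (E := E) γ' v) :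
    γ = γ' := by
  have : IsManifold 𝓘(ℝ, E) 1 G := inferInstance
  exact isMIntegralCurve_Ioo_eq_of_contMDiff_boundaryless (t₀ := 0)
    (contMDiff_mulInvariantVectorField_one v) h.isMIntegralCurve h'.isMIntegralCurve
    (by rw [h.map_zero, h'.map_zero])

theorem IsMIntegralCurveOn.mul_left {γ : ℝ → G} {v : E} {s : Set ℝ} (hs : IsOpen s)
    (h : IsMIntegralCurveOn (I := 𝓘(ℝ, E)) γ
      (mulInvariantVectorField (I := 𝓘(ℝ, E)) (G := G) v) s) (a : G) :
    IsMIntegralCurveOn (I := 𝓘(ℝ, E)) (fun t ↦ a * γ t)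
      (mulInvariantVectorField (I := 𝓘(ℝ, E)) (G := G) v) s := by
  intro t ht
  have h1 := (isMIntegralCurve_iff_hasModelDerivAt (E := E)
    (X := mulInvariantVectorField (I := 𝓘(ℝ, E)) (G := G) v)).1
    ((h t ht).hasMFDerivAt (hs.mem_nhds ht))
  have h2 := (hasModelDerivAt_mul_left (𝕜 := ℝ) (E := E) a (γ t)).comp_deriv h1 rfl
  refine HasMFDerivAt.hasMFDerivWithinAt ?_
  refine (isMIntegralCurve_iff_hasModelDerivAt (E := E) (γ := fun t ↦ a * γ t)
    (X := mulInvariantVectorField (I := 𝓘(ℝ, E)) (G := G) v)).2 ?_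
  have h3 := modelDeriv_mul_left_mul a (γ t) v
  change HasModelDerivAt ℝ _ t (ContinuousLinearMap.toSpanSingleton ℝ
    (modelDeriv ℝ E E (fun h : G ↦ (a * γ t) * h) 1 v))
  rw [← h3]
  exact h2

/-- One-parameter subgroups with given initial velocity exist. -/
theorem exists_isOneParameterSubgroup [T2Space G] [CompleteSpace E] (v : E) :
    ∃ γ : ℝ → G, IsOneParameterSubgroup (E := E) γ v := by
  have : IsManifold 𝓘(ℝ, E) 1 G := inferInstance
  have hX := contMDiff_mulInvariantVectorField_one (G := G) v
  obtain ⟨γ₀, h0, hγ₀⟩ := exists_isMIntegralCurveAt_of_contMDiffAt_boundaryless (t₀ := 0)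
    (hX.contMDiffAt (x := (1 : G)))
  obtain ⟨ε, hε, hγ₀⟩ := isMIntegralCurveAt_iff'.1 hγ₀
  rw [Real.ball_eq_Ioo, zero_sub, zero_add] at hγ₀
  -- Left translates of one local integral curve through 1 give integral curves through every point
  -- on the same interval (-ε, ε); this uniform time yields a global one.
  obtain ⟨γ, hγ0, hγ⟩ := exists_isMIntegralCurve_of_isMIntegralCurveOn hX hε
    (fun x ↦ ⟨fun t ↦ x * γ₀ t, by simp [h0], hγ₀.mul_left isOpen_Ioo x⟩) (1 : G)
  refine ⟨γ, fun s t ↦ ?_, ?_⟩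
  · have h1 := hγ.comp_add s
    have h2 : IsMIntegralCurve (I := 𝓘(ℝ, E)) (fun t ↦ γ s * γ t)
        (mulInvariantVectorField (I := 𝓘(ℝ, E)) (G := G) v) := by
      rw [isMIntegralCurve_iff_isMIntegralCurveOn] at hγ ⊢
      exact hγ.mul_left isOpen_univ _
    -- The curves t ↦ γ(t + s) and t ↦ γ(s) γ(t) are integral curves of the same left-invariant
    -- field starting at γ(s).
    have h3 := isMIntegralCurve_Ioo_eq_of_contMDiff_boundaryless (t₀ := 0) hX h1 h2 (by simp [hγ0])
    rw [add_comm]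
    exact congrFun h3 t
  · have h1 := (isMIntegralCurve_iff_hasModelDerivAt (E := E)
      (X := mulInvariantVectorField (I := 𝓘(ℝ, E)) (G := G) v)).1 (hγ 0)
    have h2 : mulInvariantVectorField (I := 𝓘(ℝ, E)) (G := G) v (γ 0) = v := by
      change modelDeriv ℝ E E (fun h : G ↦ γ 0 * h) 1 v = v
      simp only [hγ0, one_mul]
      rw [(hasModelDerivAt_id (1 : G)).modelDeriv_eq]
      rfl
    rw [h2] at h1
    exact h1

theorem IsOneParameterSubgroup.lieExp_eq [T2Space G] [CompleteSpace E] {γ : ℝ → G} {v : E}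
    (h : IsOneParameterSubgroup (E := E) γ v) : lieExp (E := E) (G := G) v = γ 1 := by
  have hex : ∃ γ : ℝ → G, IsOneParameterSubgroup (E := E) γ v := ⟨γ, h⟩
  have h1 : lieExp (E := E) (G := G) v = hex.choose 1 := dif_pos hex
  rw [h1, hex.choose_spec.unique h]

/-- By uniqueness the choice inside `lieExp` is immaterial, and rescaling time in the subgroup of v
gives that of t • v. -/
theorem isOneParameterSubgroup_lieExp [T2Space G] [CompleteSpace E] (v : E) :
    IsOneParameterSubgroup (E := E) (fun t : ℝ ↦ lieExp (E := E) (G := G) (t • v : E)) v := by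
  obtain ⟨γ, h⟩ := exists_isOneParameterSubgroup (G := G) v
  have : (fun t : ℝ ↦ lieExp (E := E) (G := G) (t • v : E)) = γ := by
    funext t
    rw [(h.comp_mul t).lieExp_eq, mul_one]
  rw [this]
  exact h

theorem IsOneParameterSubgroup.conj {γ : ℝ → G} {v : E}
    (h : IsOneParameterSubgroup (E := E) γ v) (a : G) :
    IsOneParameterSubgroup (E := E) (fun t ↦ a * γ t * a⁻¹) (lieGroupAd ℝ E a v) := by
  refine ⟨fun s t ↦ by simp only [h.1]; group, ?_⟩
  exact (hasModelDerivAt_conj a).comp_deriv h.hasModelDerivAt h.map_zero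

theorem conj_lieExp [T2Space G] [CompleteSpace E] (a : G) (v : E) :
    a * lieExp (E := E) (G := G) v * a⁻¹ = lieExp (E := E) (G := G) (lieGroupAd ℝ E a v) := by
  have h := (isOneParameterSubgroup_lieExp (G := G) v).conj a
  rw [h.lieExp_eq, one_smul]

theorem IsOneParameterSubgroup.lieGroupAd_self {γ : ℝ → G} {v : E}
    (h : IsOneParameterSubgroup (E := E) γ v) (t : ℝ) : lieGroupAd ℝ E (γ t) v = v := by
  have h1 := (h.conj (γ t)).hasModelDerivAt
  have h2 : (fun s ↦ γ t * γ s * (γ t)⁻¹) = γ := by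
    funext s
    rw [← h.1, add_comm, h.1]; group
  rw [h2] at h1
  have h3 := congrArg (fun f : ℝ →L[ℝ] E ↦ f 1) (h1.unique h.hasModelDerivAt)
  simpa using h3

end OneParameterSubgroup

/-! ### The bracket as the derivative of Ad. -/

section Adjoint

variable {𝕜 : Type*} [NontriviallyNormedField 𝕜]
  {E : Type*} [NormedAddCommGroup E] [NormedSpace 𝕜 E]
  {G : Type*} [Group G] [TopologicalSpace G] [ChartedSpace E G] [LieGroup 𝓘(𝕜, E) ∞ G]

variable (𝕜 E G) in
/-- `v ↦ (u ↦ [u, v])`, the derivative of the adjoint action at `1`. -/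
def lieGroupBracket (v : E) : E →L[𝕜] E :=
  modelDeriv 𝕜 E E (fun k : G ↦ lieGroupAd 𝕜 E k v) 1

theorem hasModelDerivAt_lieGroupAd (v : E) :
    HasModelDerivAt 𝕜 (fun k : G ↦ lieGroupAd 𝕜 E k v) 1 (lieGroupBracket 𝕜 E G v) :=
  (mdifferentiableAt_lieGroupAd v).hasModelDerivAt

theorem lieGroupBracket_smul (c : 𝕜) (u v : E) :
    lieGroupBracket 𝕜 E G (c • v) u = c • lieGroupBracket 𝕜 E G v u := by
  have h1 := hasModelDerivAt_lieGroupAd (𝕜 := 𝕜) (G := G) (c • v)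
  simp only [map_smul] at h1
  have h2 : HasModelDerivAt 𝕜 (fun w : E ↦ c • w) (lieGroupAd 𝕜 E (1 : G) v)
      (c • ContinuousLinearMap.id 𝕜 E) :=
    hasModelDerivAt_iff_hasFDerivAt.2 ((hasFDerivAt_id _).const_smul c)
  have h3 := h2.comp (hasModelDerivAt_lieGroupAd (𝕜 := 𝕜) (G := G) v) rfl
  rw [h1.unique h3]
  simp

theorem lieGroupBracket_add (u v w : E) :
    lieGroupBracket 𝕜 E G (v + w) u = lieGroupBracket 𝕜 E G v u + lieGroupBracket 𝕜 E G w u := by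
  have h1 := hasModelDerivAt_lieGroupAd (𝕜 := 𝕜) (G := G) (v + w)
  simp only [map_add] at h1
  have h3 : HasModelDerivAt 𝕜 (fun k : G ↦ lieGroupAd 𝕜 E k v + lieGroupAd 𝕜 E k w) 1
      (lieGroupBracket 𝕜 E G v + lieGroupBracket 𝕜 E G w) :=
    HasMFDerivAt.add (hasModelDerivAt_lieGroupAd v) (hasModelDerivAt_lieGroupAd w)
  rw [h1.unique h3]
  rfl

/-- If a curve in `G` has right logarithmic derivative `u` at `t`, then `Ad` along it has
derivative `[u, Ad v]`. -/
theorem hasDerivAt_lieGroupAd {γ : 𝕜 → G} {u : E} {t : 𝕜}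
    (h : HasModelDerivAt 𝕜 (fun s ↦ γ s * (γ t)⁻¹) t (ContinuousLinearMap.toSpanSingleton 𝕜 u))
    (v : E) :
    HasDerivAt (fun s ↦ lieGroupAd 𝕜 E (γ s) v)
      (lieGroupBracket 𝕜 E G (lieGroupAd 𝕜 E (γ t) v) u) t := by
  rw [← hasModelDerivAt_toSpanSingleton]
  have h1 := (hasModelDerivAt_lieGroupAd (𝕜 := 𝕜) (G := G) (lieGroupAd 𝕜 E (γ t) v)).comp_deriv h
    (by simp)
  refine h1.congr (Eventually.of_forall fun s ↦ ?_)
  rw [← lieGroupAd_mul]; group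

end Adjoint

/-! ### Complex linearity of Ad and of the bracket. -/

section ComplexLieGroup

variable {EK : Type*} [NormedAddCommGroup EK] [NormedSpace ℂ EK]
  {K : Type*} [Group K] [TopologicalSpace K] [ChartedSpace EK K] [LieGroup 𝓘(ℂ, EK) ω K]

/-- Conjugation is holomorphic, so its complex derivative is also its real one. This is what lets i
be moved through Ad and the bracket in the real calculus below. -/
theorem lieGroupAd_real_eq (k : K) (v : EK) : lieGroupAd ℝ EK k v = lieGroupAd ℂ EK k v := by
  have h := (hasModelDerivAt_conj (𝕜 := ℂ) (E := EK) k).restrictScalars_real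
  rw [(hasModelDerivAt_conj (𝕜 := ℝ) (E := EK) k).unique h]
  rfl

theorem lieGroupAd_real_smul (k : K) (c : ℂ) (v : EK) :
    lieGroupAd ℝ EK k (c • v) = c • lieGroupAd ℝ EK k v := by
  simp only [lieGroupAd_real_eq, map_smul]

theorem lieGroupBracket_real_eq (u v : EK) :
    lieGroupBracket ℝ EK K v u = lieGroupBracket ℂ EK K v u := by
  have h := (hasModelDerivAt_lieGroupAd (𝕜 := ℂ) (G := K) v).restrictScalars_real
  simp only [← lieGroupAd_real_eq] at h
  rw [(hasModelDerivAt_lieGroupAd (𝕜 := ℝ) (G := K) v).unique h]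
  rfl

theorem lieGroupBracket_real_smul_left (c : ℂ) (u v : EK) :
    lieGroupBracket ℝ EK K v (c • u) = c • lieGroupBracket ℝ EK K v u := by
  simp only [lieGroupBracket_real_eq, map_smul]

theorem lieGroupBracket_real_smul_right (c : ℂ) (u v : EK) :
    lieGroupBracket ℝ EK K (c • v) u = c • lieGroupBracket ℝ EK K v u := by
  simp only [lieGroupBracket_real_eq, lieGroupBracket_smul]

end ComplexLieGroup

/-! ### The splitting 𝔩 ⊕ i𝔩 and the polar decomposition. -/

section Complexification

variable {EL : Type*} [NormedAddCommGroup EL] [NormedSpace ℝ EL]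
  {EK : Type*} [NormedAddCommGroup EK] [NormedSpace ℂ EK]
  {L : Type*} [Group L] [TopologicalSpace L] [ChartedSpace EL L]
  {K : Type*} [Group K] [TopologicalSpace K] [ChartedSpace EK K]

variable (EL EK) in
/-- `lieMap` as a linear map between the model spaces. -/
def lieMapL (ι : L →* K) : EL →L[ℝ] EK := modelDeriv ℝ EL EK (ι : L → K) 1

theorem complexLie_eq (ι : L →* K) (a b : EL) :
    complexLie (EL := EL) (EK := EK) ι a b
      = (lieMapL EL EK ι a + Complex.I • lieMapL EL EK ι b : EK) := rfl

variable (EL EK) in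
/-- `(a, b) ↦ a + √-1 b` as a linear map. -/
def complexLieL (ι : L →* K) : EL × EL →L[ℝ] EK :=
  (lieMapL EL EK ι).comp (ContinuousLinearMap.fst ℝ EL EL)
    + Complex.I • (lieMapL EL EK ι).comp (ContinuousLinearMap.snd ℝ EL EL)

theorem complexLieL_apply (ι : L →* K) (p : EL × EL) :
    complexLieL EL EK ι p = lieMapL EL EK ι p.1 + Complex.I • lieMapL EL EK ι p.2 := rfl

theorem IsComplexification.bijective {ι : L →* K} (hι : IsComplexification (EL := EL) (EK := EK) ι) :
    Function.Bijective (complexLieL EL EK ι) :=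
  Function.bijective_iff_existsUnique _ |>.2 fun v ↦ hι.lieAlgebra v

/-- The decomposition of the Lie algebra of the complexification as `𝔩 ⊕ √-1 𝔩`. -/
def IsComplexification.decomp [FiniteDimensional ℝ EL] {ι : L →* K}
    (hι : IsComplexification (EL := EL) (EK := EK) ι) : (EL × EL) ≃L[ℝ] EK :=
  haveI : FiniteDimensional ℝ EK :=
    (LinearEquiv.ofBijective (complexLieL EL EK ι).toLinearMap hι.bijective).finiteDimensional
  (LinearEquiv.ofBijective (complexLieL EL EK ι).toLinearMap hι.bijective).toContinuousLinearEquiv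

variable [FiniteDimensional ℝ EL] {ι : L →* K} (hι : IsComplexification (EL := EL) (EK := EK) ι)

/-- The projection `a + √-1 b ↦ a`. -/
def IsComplexification.re : EK →L[ℝ] EL :=
  (ContinuousLinearMap.fst ℝ EL EL).comp (hι.decomp.symm : EK →L[ℝ] EL × EL)

/-- The projection `a + √-1 b ↦ b`. -/
def IsComplexification.im : EK →L[ℝ] EL :=
  (ContinuousLinearMap.snd ℝ EL EL).comp (hι.decomp.symm : EK →L[ℝ] EL × EL)

theorem IsComplexification.re_add_im (u : EK) :
    lieMapL EL EK ι (hι.re u) + Complex.I • lieMapL EL EK ι (hι.im u) = u :=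
  hι.decomp.apply_symm_apply u

theorem IsComplexification.decomp_symm_apply (a b : EL) :
    hι.decomp.symm (lieMapL EL EK ι a + Complex.I • lieMapL EL EK ι b) = (a, b) :=
  hι.decomp.symm_apply_apply (a, b)

theorem IsComplexification.im_apply (a b : EL) :
    hι.im (lieMapL EL EK ι a + Complex.I • lieMapL EL EK ι b) = b :=
  congrArg Prod.snd (hι.decomp_symm_apply a b)

theorem IsComplexification.im_lieMapL (a : EL) : hι.im (lieMapL EL EK ι a) = 0 := by
  simpa using hι.im_apply a 0

theorem IsComplexification.im_I_smul_lieMapL (b : EL) :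
    hι.im (Complex.I • lieMapL EL EK ι b) = b := by
  simpa using hι.im_apply 0 b

variable (EL EK) in
/-- The map `ξ ↦ e^{√-1 ξ}`. -/
def polarExp (ι : L →* K) (ξ : EL) : K := lieExp (E := EK) (G := K) (Complex.I • lieMapL EL EK ι ξ : EK)

theorem expI_eq (ι : L →* K) (ξ : EL) : expI (EL := EL) (EK := EK) ι ξ = polarExp EL EK ι ξ := by
  have h0 : lieMapL EL EK ι 0 + Complex.I • lieMapL EL EK ι ξ = Complex.I • lieMapL EL EK ι ξ := by
    rw [map_zero, zero_add]
  have h : (complexLie (EL := EL) (EK := EK) ι 0 ξ : EK) = Complex.I • lieMapL EL EK ι ξ :=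
    (complexLie_eq ι 0 ξ).trans h0
  exact congrArg (lieExp (E := EK) (G := K)) h

theorem IsComplexification.polar' {ι : L →* K} (hι : IsComplexification (EL := EL) (EK := EK) ι) :
    ∃ D : Diffeomorph (𝓘(ℝ, EL).prod 𝓘(ℝ, EL)) 𝓘(ℝ, EK) (L × EL) K ∞,
      ∀ (a : L) (ξ : EL), D (a, ξ) = ι a * polarExp EL EK ι ξ := by
  obtain ⟨D, hD⟩ := hι.polar
  exact ⟨D, fun a ξ ↦ by rw [hD, expI_eq]⟩

/-- The polar decomposition `L × 𝔩 ≃ K`. -/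
def IsComplexification.polarDiffeo {ι : L →* K}
    (hι : IsComplexification (EL := EL) (EK := EK) ι) :
    Diffeomorph (𝓘(ℝ, EL).prod 𝓘(ℝ, EL)) 𝓘(ℝ, EK) (L × EL) K ∞ := hι.polar'.choose

theorem IsComplexification.polarDiffeo_apply {ι : L →* K}
    (hι : IsComplexification (EL := EL) (EK := EK) ι) (a : L) (ξ : EL) :
    hι.polarDiffeo (a, ξ) = ι a * polarExp EL EK ι ξ := hι.polar'.choose_spec a ξ

theorem IsComplexification.t2Space [T2Space L] {ι : L →* K}
    (hι : IsComplexification (EL := EL) (EK := EK) ι) : T2Space K :=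
  hι.polarDiffeo.toHomeomorph.t2Space

/-- The component in `L` of the polar decomposition. -/
def IsComplexification.polarL {ι : L →* K}
    (hι : IsComplexification (EL := EL) (EK := EK) ι) (k : K) : L := (hι.polarDiffeo.symm k).1

/-- The logarithm of the positive part of the polar decomposition. -/
def IsComplexification.polarLog {ι : L →* K}
    (hι : IsComplexification (EL := EL) (EK := EK) ι) (k : K) : EL := (hι.polarDiffeo.symm k).2

theorem IsComplexification.polar_eq {ι : L →* K}
    (hι : IsComplexification (EL := EL) (EK := EK) ι) (k : K) :
    ι (hι.polarL k) * polarExp EL EK ι (hι.polarLog k) = k := by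
  rw [← hι.polarDiffeo_apply]
  exact hι.polarDiffeo.apply_symm_apply k

theorem IsComplexification.polarLog_mul {ι : L →* K}
    (hι : IsComplexification (EL := EL) (EK := EK) ι) (a : L) (ξ : EL) :
    hι.polarLog (ι a * polarExp EL EK ι ξ) = ξ := by
  rw [← hι.polarDiffeo_apply, polarLog, hι.polarDiffeo.symm_apply_apply]

theorem IsComplexification.polarL_mul {ι : L →* K}
    (hι : IsComplexification (EL := EL) (EK := EK) ι) (a : L) (ξ : EL) :
    hι.polarL (ι a * polarExp EL EK ι ξ) = a := by
  rw [← hι.polarDiffeo_apply, polarL, hι.polarDiffeo.symm_apply_apply]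

theorem IsComplexification.polarLog_polarExp {ι : L →* K}
    (hι : IsComplexification (EL := EL) (EK := EK) ι) (ξ : EL) :
    hι.polarLog (polarExp EL EK ι ξ) = ξ := by
  simpa using hι.polarLog_mul 1 ξ

theorem IsComplexification.polarL_polarExp {ι : L →* K}
    (hι : IsComplexification (EL := EL) (EK := EK) ι) (ξ : EL) :
    hι.polarL (polarExp EL EK ι ξ) = 1 := by
  simpa using hι.polarL_mul 1 ξ

/-- This makes `polarLog` a global coordinate on L\K with values in 𝔩. -/
theorem IsComplexification.polarLog_map_mul {ι : L →* K}
    (hι : IsComplexification (EL := EL) (EK := EK) ι) (a : L) (k : K) :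
    hι.polarLog (ι a * k) = hι.polarLog k := by
  conv_lhs => rw [← hι.polar_eq k, ← mul_assoc, ← map_mul, hι.polarLog_mul]

theorem IsComplexification.contMDiff_polarL {ι : L →* K}
    (hι : IsComplexification (EL := EL) (EK := EK) ι) :
    ContMDiff 𝓘(ℝ, EK) 𝓘(ℝ, EL) ∞ hι.polarL :=
  contMDiff_fst.comp hι.polarDiffeo.symm.contMDiff

theorem IsComplexification.contMDiff_polarLog {ι : L →* K}
    (hι : IsComplexification (EL := EL) (EK := EK) ι) :
    ContMDiff 𝓘(ℝ, EK) 𝓘(ℝ, EL) ∞ hι.polarLog :=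
  contMDiff_snd.comp hι.polarDiffeo.symm.contMDiff

theorem IsComplexification.contMDiff_polarExp {ι : L →* K}
    (hι : IsComplexification (EL := EL) (EK := EK) ι) :
    ContMDiff 𝓘(ℝ, EL) 𝓘(ℝ, EK) ∞ (polarExp EL EK ι) := by
  have h := hι.polarDiffeo.contMDiff.comp
    (contMDiff_const (c := (1 : L)).prodMk (contMDiff_id (I := 𝓘(ℝ, EL)) (M := EL) (n := ∞)))
  have h2 : (polarExp EL EK ι) = hι.polarDiffeo ∘ fun x : EL ↦ ((1 : L), id x) := by
    funext ξ
    simp [hι.polarDiffeo_apply]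
  rw [h2]
  exact h

end Complexification

/-! ### The right logarithmic derivative of ξ ↦ e^{iξ}. -/

section ComplexificationCalculus

variable {EL : Type*} [NormedAddCommGroup EL] [NormedSpace ℝ EL] [FiniteDimensional ℝ EL]
  {EK : Type*} [NormedAddCommGroup EK] [NormedSpace ℂ EK] [FiniteDimensional ℂ EK]
  {L : Type*} [Group L] [TopologicalSpace L] [ChartedSpace EL L] [LieGroup 𝓘(ℝ, EL) ∞ L] [T2Space L]
  {K : Type*} [Group K] [TopologicalSpace K] [ChartedSpace EK K] [LieGroup 𝓘(ℂ, EK) ω K]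
  {ι : L →* K} (hι : IsComplexification (EL := EL) (EK := EK) ι)

include hι

theorem IsComplexification.hasModelDerivAt_one :
    HasModelDerivAt ℝ (ι : L → K) 1 (lieMapL EL EK ι) :=
  (hι.contMDiff.mdifferentiable (by simp) 1).hasModelDerivAt

theorem IsComplexification.isOneParameterSubgroup_lieExp (v : EK) :
    IsOneParameterSubgroup (E := EK) (fun t : ℝ ↦ lieExp (E := EK) (G := K) (t • v : EK)) v := by
  have := hι.t2Space
  have := FiniteDimensional.complete ℂ EK
  exact _root_.isOneParameterSubgroup_lieExp v

theorem IsComplexification.isOneParameterSubgroup_polarExp (ξ : EL) :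
    IsOneParameterSubgroup (E := EK) (fun t : ℝ ↦ polarExp EL EK ι (t • ξ))
      (Complex.I • lieMapL EL EK ι ξ : EK) := by
  have h := hι.isOneParameterSubgroup_lieExp (Complex.I • lieMapL EL EK ι ξ : EK)
  simpa only [polarExp, map_smul, smul_comm Complex.I] using h

theorem IsComplexification.polarExp_zero : polarExp EL EK ι 0 = 1 := by
  simpa using (hι.isOneParameterSubgroup_polarExp 0).map_zero

theorem IsComplexification.polarExp_add_smul (s t : ℝ) (ξ : EL) :
    polarExp EL EK ι ((s + t) • ξ) = polarExp EL EK ι (s • ξ) * polarExp EL EK ι (t • ξ) :=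
  (hι.isOneParameterSubgroup_polarExp ξ).1 s t

theorem IsComplexification.lieGroupAd_map (a : L) (b : EL) :
    lieGroupAd ℝ EK (ι a) (lieMapL EL EK ι b) = lieMapL EL EK ι (lieGroupAd ℝ EL a b) := by
  have h1 := (hasModelDerivAt_conj (𝕜 := ℝ) (E := EK) (ι a)).comp hι.hasModelDerivAt_one
    (map_one ι)
  have h2 := hι.hasModelDerivAt_one.comp (hasModelDerivAt_conj (𝕜 := ℝ) (E := EL) a) (by simp)
  simp only [map_mul, map_inv] at h2
  exact congrArg (fun f : EL →L[ℝ] EK ↦ f b) (h1.unique h2)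

theorem IsComplexification.lieGroupBracket_map (a b : EL) :
    lieGroupBracket ℝ EK K (lieMapL EL EK ι b) (lieMapL EL EK ι a)
      = lieMapL EL EK ι (lieGroupBracket ℝ EL L b a) := by
  have h1 := (hasModelDerivAt_lieGroupAd (𝕜 := ℝ) (G := K) (lieMapL EL EK ι b)).comp
    hι.hasModelDerivAt_one (map_one ι)
  simp only [hι.lieGroupAd_map] at h1
  have h2 := (hasModelDerivAt_iff_hasFDerivAt.2
    ((lieMapL EL EK ι).hasFDerivAt (x := lieGroupAd ℝ EL (1 : L) b))).comp
    (hasModelDerivAt_lieGroupAd (𝕜 := ℝ) (G := L) b) rfl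
  exact congrArg (fun f : EL →L[ℝ] EK ↦ f a) (h1.unique h2)

theorem IsComplexification.conj_polarExp (a : L) (ξ : EL) :
    ι a * polarExp EL EK ι ξ * (ι a)⁻¹ = polarExp EL EK ι (lieGroupAd ℝ EL a ξ) := by
  have := hι.t2Space
  have := FiniteDimensional.complete ℂ EK
  rw [polarExp, conj_lieExp, polarExp, lieGroupAd_real_smul, hι.lieGroupAd_map]

/-- For u = a + ib one has [iξ, u] = i[ξ, a] - [ξ, b], so only the real part of u contributes. -/
theorem IsComplexification.im_lieGroupBracket_I (ξ : EL) (u : EK) :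
    hι.im (lieGroupBracket ℝ EK K u (Complex.I • lieMapL EL EK ι ξ))
      = lieGroupBracket ℝ EL L (hι.re u) ξ := by
  conv_lhs => rw [← hι.re_add_im u]
  rw [lieGroupBracket_real_smul_left, lieGroupBracket_add, lieGroupBracket_real_smul_right,
    hι.lieGroupBracket_map, hι.lieGroupBracket_map, smul_add, smul_smul, Complex.I_mul_I,
    neg_one_smul, ← map_neg, add_comm, hι.im_apply]

omit hι in
variable (EL EK) in
/-- The right logarithmic derivative of `ξ ↦ e^{√-1 ξ}`. -/
def polarLogDeriv (ι : L →* K) (ξ : EL) : EL →L[ℝ] EK :=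
  modelDeriv ℝ EL EK (fun η ↦ polarExp EL EK ι η * (polarExp EL EK ι ξ)⁻¹) ξ

theorem IsComplexification.hasModelDerivAt_polarExp_mul_inv (ξ : EL) :
    HasModelDerivAt ℝ (fun η ↦ polarExp EL EK ι η * (polarExp EL EK ι ξ)⁻¹) ξ
      (polarLogDeriv EL EK ι ξ) := by
  refine MDifferentiableAt.hasModelDerivAt ?_
  exact ((hι.contMDiff_polarExp.mul contMDiff_const).mdifferentiable (by simp) ξ)

theorem IsComplexification.contDiff_polarLogDeriv : ContDiff ℝ ∞ (polarLogDeriv EL EK ι) := by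
  rw [contDiff_iff_contDiffAt]
  intro ξ
  refine contDiffAt_modelDeriv_param (𝕜 := ℝ) (F := EL) (F' := EL) (E' := EK) (M := K) (c := 1)
    (f := fun z η ↦ polarExp EL EK ι η * (polarExp EL EK ι z)⁻¹) (g := fun z ↦ z) ?_
    contDiffAt_id (by simp)
  have hA : ContMDiff 𝓘(ℝ, EL × EL) 𝓘(ℝ, EK) ∞ (fun p : EL × EL ↦ polarExp EL EK ι p.1) :=
    hι.contMDiff_polarExp.comp contDiff_fst.contMDiff
  have hB : ContMDiff 𝓘(ℝ, EL × EL) 𝓘(ℝ, EK) ∞ (fun p : EL × EL ↦ polarExp EL EK ι p.2) :=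
    hι.contMDiff_polarExp.comp contDiff_snd.contMDiff
  exact (hB.mul hA.inv) _

theorem IsComplexification.polarLogDeriv_zero (η : EL) :
    polarLogDeriv EL EK ι 0 η = Complex.I • lieMapL EL EK ι η := by
  have h1 := hι.hasModelDerivAt_polarExp_mul_inv 0
  simp only [hι.polarExp_zero, inv_one, mul_one] at h1
  have h2 : HasModelDerivAt ℝ (fun t : ℝ ↦ t • η) 0 (ContinuousLinearMap.toSpanSingleton ℝ η) :=
    hasModelDerivAt_toSpanSingleton.2 (by simpa using (hasDerivAt_id (0 : ℝ)).smul_const η)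
  have h3 := h1.comp_deriv h2 (zero_smul _ _)
  have h4 := congrArg (fun f : ℝ →L[ℝ] EK ↦ f 1)
    (h3.unique (hι.isOneParameterSubgroup_polarExp η).hasModelDerivAt)
  simpa using h4

/-- Differentiate e^{i(s+t)z} = e^{isz} e^{itz} in z: right logarithmic derivatives add up after
conjugating the second by the first factor. The derivative in s at any time is thereby reduced to
that at 0. -/
theorem IsComplexification.polarLogDeriv_add_smul (s t : ℝ) (ξ η : EL) :
    polarLogDeriv EL EK ι ((s + t) • ξ) ((s + t) • η)
      = polarLogDeriv EL EK ι (s • ξ) (s • η)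
        + lieGroupAd ℝ EK (polarExp EL EK ι (s • ξ)) (polarLogDeriv EL EK ι (t • ξ) (t • η)) := by
  have hs : ∀ c : ℝ, HasModelDerivAt ℝ (fun z : EL ↦ c • z) ξ (c • ContinuousLinearMap.id ℝ EL) :=
    fun c ↦ hasModelDerivAt_iff_hasFDerivAt.2 ((hasFDerivAt_id ξ).const_smul c)
  have h0 := fun c : ℝ ↦ (hι.hasModelDerivAt_polarExp_mul_inv (c • ξ)).comp (hs c) rfl
  have h1 := (hasModelDerivAt_conj (𝕜 := ℝ) (E := EK) (polarExp EL EK ι (s • ξ))).comp (h0 t)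
    (by simp)
  have h2 := (h0 s).mul_of_eq_one h1 (by simp) (by simp)
  have h3 := h2.congr (g := fun z ↦ polarExp EL EK ι ((s + t) • z)
    * (polarExp EL EK ι ((s + t) • ξ))⁻¹) (Eventually.of_forall fun z ↦ by
      rw [hι.polarExp_add_smul, hι.polarExp_add_smul]; group)
  have h4 := congrArg (fun f : EL →L[ℝ] EK ↦ f η) ((h0 (s + t)).unique h3)
  simpa using h4

theorem IsComplexification.hasDerivAt_lieGroupAd_polarExp (ξ : EL) (u : EK) (s : ℝ) :
    HasDerivAt (fun s : ℝ ↦ lieGroupAd ℝ EK (polarExp EL EK ι (s • ξ)) u)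
      (lieGroupBracket ℝ EK K (lieGroupAd ℝ EK (polarExp EL EK ι (s • ξ)) u)
        (Complex.I • lieMapL EL EK ι ξ)) s :=
  hasDerivAt_lieGroupAd ((hι.isOneParameterSubgroup_polarExp ξ).hasModelDerivAt_mul_inv s) u

/-- This is the differential form of the classical formula D_ξ(η) = ∫₀¹ Ad(e^{isξ})(iη) ds, where D
is `polarLogDeriv`. -/
theorem IsComplexification.hasDerivAt_polarLogDeriv_smul (ξ η : EL) (s : ℝ) :
    HasDerivAt (fun s : ℝ ↦ polarLogDeriv EL EK ι (s • ξ) (s • η))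
      (lieGroupAd ℝ EK (polarExp EL EK ι (s • ξ)) (Complex.I • lieMapL EL EK ι η)) s := by
  have h0 : HasDerivAt (fun h : ℝ ↦ polarLogDeriv EL EK ι (h • ξ) (h • η))
      (Complex.I • lieMapL EL EK ι η) 0 := by
    have hd : Differentiable ℝ (fun h : ℝ ↦ polarLogDeriv EL EK ι (h • ξ) η) := by
      have := hι.contDiff_polarLogDeriv
      refine ContDiff.differentiable (n := ∞) ?_ (by simp)
      fun_prop
    -- Since D_{hξ}(hη) = h D_{hξ}(η) and the factor h vanishes at 0, the derivative there is D_0(η)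
    -- = iη.
    have h1 := (hasDerivAt_id (0 : ℝ)).smul (hd 0).hasDerivAt
    simpa [hι.polarLogDeriv_zero, Pi.smul_def'] using h1
  have h1 : HasDerivAt (fun r : ℝ ↦ r - s) 1 s := (hasDerivAt_id s).sub_const s
  rw [← sub_self s] at h0
  have h2 := HasDerivAt.scomp (h := fun r : ℝ ↦ r - s) s h0 h1
  rw [one_smul] at h2
  have h3 := ((lieGroupAd ℝ EK (polarExp EL EK ι (s • ξ))).hasFDerivAt.comp_hasDerivAt s
    h2).const_add (polarLogDeriv EL EK ι (s • ξ) (s • η))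
  refine h3.congr_of_eventuallyEq (Eventually.of_forall fun r ↦ ?_)
  have := hι.polarLogDeriv_add_smul s (r - s) ξ η
  simpa using this

omit hι in
variable (K) in
/-- `v ↦ [u, v]` as a continuous linear map. -/
def lieGroupBracketRight (u : EK) : EK →L[ℝ] EK :=
  haveI := FiniteDimensional.complexToReal EK
  LinearMap.toContinuousLinearMap
    { toFun := fun v ↦ lieGroupBracket ℝ EK K v u
      map_add' := fun v w ↦ lieGroupBracket_add u v w
      map_smul' := fun c v ↦ lieGroupBracket_smul c u v }

/-- Both sides vanish at s = 0 and have the same s-derivative [iξ, Ad(e^{isξ})(iη)]. -/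
theorem IsComplexification.lieGroupAd_polarExp_sub (ξ η : EL) (s : ℝ) :
    lieGroupAd ℝ EK (polarExp EL EK ι (s • ξ)) (Complex.I • lieMapL EL EK ι η)
        - Complex.I • lieMapL EL EK ι η
      = lieGroupBracket ℝ EK K (polarLogDeriv EL EK ι (s • ξ) (s • η))
          (Complex.I • lieMapL EL EK ι ξ) := by
  have h1 := fun s ↦
    hι.hasDerivAt_lieGroupAd_polarExp ξ (Complex.I • lieMapL EL EK ι η) s
  have h2 := fun s ↦ (lieGroupBracketRight K (Complex.I • lieMapL EL EK ι ξ)).hasFDerivAt.comp_hasDerivAt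
    s (hι.hasDerivAt_polarLogDeriv_smul ξ η s)
  have h3 := fun s ↦ (h1 s).sub (h2 s)
  have h4 : ∀ s, _ = _ := fun s ↦ is_const_of_deriv_eq_zero (fun s ↦ (h3 s).differentiableAt)
    (fun s ↦ (h3 s).deriv.trans (sub_self _)) s 0
  have h5 := h4 s
  simp only [Pi.sub_apply, Function.comp_apply, zero_smul, map_zero, sub_zero, hι.polarExp_zero,
    lieGroupAd_one] at h5
  exact sub_eq_iff_eq_add.2 ((sub_eq_iff_eq_add.1 h5).trans (add_comm _ _))

end ComplexificationCalculus

/-! ### Differentiation under the integral sign. -/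

section ParametricIntegral

/-- Differentiation under the integral sign for a `C^1` integrand. -/
theorem hasFDerivAt_intervalIntegral_of_contDiff {E : Type*} [NormedAddCommGroup E]
    [NormedSpace ℝ E] [FiniteDimensional ℝ E] {f : E → ℝ → ℝ}
    (hf : ContDiff ℝ ∞ (Function.uncurry f)) (x₀ : E) :
    HasFDerivAt (fun x ↦ ∫ t in (0 : ℝ)..1, f x t)
      (∫ t in (0 : ℝ)..1, fderiv ℝ (fun x ↦ f x t) x₀) x₀ := by
  have hc : Continuous fun p : E × ℝ ↦ fderiv ℝ (fun x ↦ f x p.2) p.1 := by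
    refine (ContDiff.fderiv (f := fun (p : E × ℝ) x ↦ f x p.2) (g := Prod.fst) (n := 0) (m := ∞)
      ?_ contDiff_fst (by simp)).continuous
    exact hf.comp (contDiff_snd.prodMk (contDiff_snd.comp contDiff_fst))
  have hfc : ∀ x, Continuous (f x) := fun x ↦
    hf.continuous.comp (continuous_const.prodMk continuous_id)
  obtain ⟨C, hC⟩ := ((isCompact_closedBall x₀ 1).prod (isCompact_Icc (a := (0 : ℝ)) (b := 1))).exists_bound_of_continuousOn
    hc.continuousOn
  refine intervalIntegral.hasFDerivAt_integral_of_dominated_of_fderiv_le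
    (F' := fun x t ↦ fderiv ℝ (fun x ↦ f x t) x) (bound := fun _ ↦ C)
    (Metric.ball_mem_nhds x₀ one_pos)
    (Eventually.of_forall fun x ↦ (hfc x).aestronglyMeasurable)
    ((hfc x₀).intervalIntegrable _ _)
    (hc.comp (continuous_const.prodMk continuous_id)).aestronglyMeasurable
    (Eventually.of_forall fun t ht x hx ↦ hC (x, t) ⟨Metric.ball_subset_closedBall hx, ?_⟩)
    intervalIntegrable_const
    (Eventually.of_forall fun t _ x _ ↦ DifferentiableAt.hasFDerivAt ?_)
  · rw [uIoc_of_le zero_le_one] at ht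
    exact Ioc_subset_Icc_self ht
  · have h1 : ContDiff ℝ ∞ fun x ↦ f x t := hf.comp (contDiff_id.prodMk contDiff_const)
    exact h1.differentiable (by simp) x

end ParametricIntegral

/-! ### The Kähler metric on one tangent space. -/

section KahlerLinear

variable {E : Type*} [NormedAddCommGroup E] [NormedSpace ℂ E]
  {X : Type*} [TopologicalSpace X] [ChartedSpace E X] [IsManifold 𝓘(ℂ, E) ω X]

/-- The Riemannian metric at a point as a bilinear form on the model space. -/
def KahlerMetric.metricL (g : KahlerMetric E X) (x : X) : E →L[ℝ] E →L[ℝ] ℝ := g.inner x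

theorem KahlerMetric.metricL_symm (g : KahlerMetric E X) (x : X) (u v : E) :
    g.metricL x u v = g.metricL x v u := g.symm x u v

theorem KahlerMetric.metricL_pos (g : KahlerMetric E X) (x : X) {u : E} (hu : u ≠ 0) :
    0 < g.metricL x u u := g.pos x u hu

theorem KahlerMetric.metricL_nonneg (g : KahlerMetric E X) (x : X) (u : E) :
    0 ≤ g.metricL x u u := by
  rcases eq_or_ne u 0 with rfl | hu
  · simp
  · exact (g.metricL_pos x hu).le

theorem KahlerMetric.metricL_I_I (g : KahlerMetric E X) (x : X) (u v : E) :
    g.metricL x (Complex.I • u) (Complex.I • v) = g.metricL x u v := g.hermitian x u v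

theorem KahlerMetric.metricL_I_left (g : KahlerMetric E X) (x : X) (u v : E) :
    g.metricL x (Complex.I • u) v = -g.metricL x (Complex.I • v) u := by
  rw [← g.metricL_I_I, smul_smul, Complex.I_mul_I, neg_one_smul, map_neg,
    neg_apply, g.metricL_symm]

end KahlerLinear

theorem hasModelDerivAt_inv_one {E : Type*} [NormedAddCommGroup E] [NormedSpace ℝ E]
    {G : Type*} [Group G] [TopologicalSpace G] [ChartedSpace E G] [LieGroup 𝓘(ℝ, E) ∞ G] :
    HasModelDerivAt ℝ (fun a : G ↦ a⁻¹) 1 (-ContinuousLinearMap.id ℝ E) := by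
  have h1 : HasModelDerivAt ℝ (fun a : G ↦ a⁻¹) 1 (modelDeriv ℝ E E (fun a : G ↦ a⁻¹) 1) :=
    ((contMDiff_inv 𝓘(ℝ, E) (n := ∞)).mdifferentiable (by simp) 1).hasModelDerivAt
  have h2 := (hasModelDerivAt_id (𝕜 := ℝ) (E := E) (1 : G)).mul_of_eq_one h1 rfl inv_one
  simp only [mul_inv_cancel] at h2
  have h3 := h2.unique (hasModelDerivAt_const 1 1)
  rw [← eq_neg_of_add_eq_zero_right h3]
  exact h1

/-! ### First derivatives of the moment map along orbits. -/

section MomentMap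

variable {EL : Type*} [NormedAddCommGroup EL] [NormedSpace ℝ EL] [FiniteDimensional ℝ EL]
  {EK : Type*} [NormedAddCommGroup EK] [NormedSpace ℂ EK] [FiniteDimensional ℂ EK]
  {EX : Type*} [NormedAddCommGroup EX] [NormedSpace ℂ EX] [FiniteDimensional ℂ EX]
  {L : Type*} [Group L] [TopologicalSpace L] [ChartedSpace EL L] [LieGroup 𝓘(ℝ, EL) ∞ L] [T2Space L]
  {K : Type*} [Group K] [TopologicalSpace K] [ChartedSpace EK K] [LieGroup 𝓘(ℂ, EK) ω K]
  {ι : L →* K} (hι : IsComplexification (EL := EL) (EK := EK) ι)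
  {X : Type*} [TopologicalSpace X] [ChartedSpace EX X] [IsManifold 𝓘(ℂ, EX) ω X]
  [MulAction K X] [ContMDiffSMul 𝓘(ℂ, EK) 𝓘(ℂ, EX) ω K X]
  {g : KahlerMetric EX X} {m : X → Module.Dual ℝ (GroupLieAlgebra 𝓘(ℝ, EL) L)}
  (hm : IsMomentMap ι g m)
  {ζ : Module.Dual ℝ (GroupLieAlgebra 𝓘(ℝ, EL) L)}
  (hζ : ∀ (a : L) (ξ : GroupLieAlgebra 𝓘(ℝ, EL) L), ζ (lieAd a ξ) = ζ ξ)

variable (EK EX K) in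
/-- The infinitesimal action of the Lie algebra at a point. -/
def actionDeriv (x : X) : EK →L[ℂ] EX := modelDeriv ℂ EK EX (fun k : K ↦ k • x) 1

theorem contMDiff_smul_point (x : X) :
    ContMDiff 𝓘(ℂ, EK) 𝓘(ℂ, EX) ω (fun k : K ↦ k • x) :=
  (ContMDiffSMul.contMDiff_smul (I := 𝓘(ℂ, EK)) (I' := 𝓘(ℂ, EX)) (n := ω) (G := K) (M := X)).comp
    (contMDiff_id.prodMk contMDiff_const)

include EK in
theorem contMDiff_const_smul_real (k : K) :
    ContMDiff 𝓘(ℝ, EX) 𝓘(ℝ, EX) ω (fun x : X ↦ k • x) :=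
  ((ContMDiffSMul.contMDiff_smul (I := 𝓘(ℂ, EK)) (I' := 𝓘(ℂ, EX)) (n := ω) (G := K) (M := X)).comp
    (contMDiff_const.prodMk contMDiff_id)).restrictScalars_real

theorem hasModelDerivAt_smul_point (x : X) :
    HasModelDerivAt ℝ (fun k : K ↦ k • x) 1 ((actionDeriv EK EX K x).restrictScalars ℝ) :=
  ((contMDiff_smul_point x).mdifferentiable (by simp) 1).hasModelDerivAt.restrictScalars_real

variable (EL EK K ι g) in
/-- The derivative at `1` of `k ↦ ⟨m (k x), ξ⟩`. -/
def momentDeriv (x : X) (ξ : EL) : EK →L[ℝ] ℝ :=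
  (g.metricL x (Complex.I • actionDeriv EK EX K x (lieMapL EL EK ι ξ))).comp
    ((actionDeriv EK EX K x).restrictScalars ℝ)

/-- The moment map, with values in the dual of the model space. -/
def momentL (m : X → Module.Dual ℝ (GroupLieAlgebra 𝓘(ℝ, EL) L)) (x : X) : EL →L[ℝ] ℝ :=
  LinearMap.toContinuousLinearMap (show EL →ₗ[ℝ] ℝ from m x)

include hι in
theorem IsComplexification.fundamentalVector_eq (x : X) (ξ : EL) :
    fundamentalVector (EL := EL) (EX := EX) ι ξ x = actionDeriv EK EX K x (lieMapL EL EK ι ξ) := by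
  have h := (hasModelDerivAt_smul_point (EK := EK) (EX := EX) (K := K) x).comp
    hι.hasModelDerivAt_one (map_one ι)
  exact congrArg (fun f : EL →L[ℝ] EX ↦ f ξ) h.modelDeriv_eq

theorem momentDeriv_lieMapL (x : X) (ξ η : EL) :
    momentDeriv EL EK K ι g x ξ (lieMapL EL EK ι η)
      = -momentDeriv EL EK K ι g x η (lieMapL EL EK ι ξ) :=
  g.metricL_I_left x _ _

/-- In imaginary directions ω(ξ*, Iη*) = g(Iξ*, Iη*) = g(ξ*, η*). Its symmetry enters the closedness
of α and its positivity the convexity of Φ. -/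
theorem momentDeriv_I_lieMapL (x : X) (ξ η : EL) :
    momentDeriv EL EK K ι g x ξ (Complex.I • lieMapL EL EK ι η)
      = g.metricL x (actionDeriv EK EX K x (lieMapL EL EK ι ξ))
          (actionDeriv EK EX K x (lieMapL EL EK ι η)) := by
  have : (actionDeriv EK EX K x) (Complex.I • lieMapL EL EK ι η)
    = Complex.I • (actionDeriv EK EX K x) (lieMapL EL EK ι η) := map_smul _ _ _
  simp only [momentDeriv, ContinuousLinearMap.comp_apply, ContinuousLinearMap.coe_restrictScalars',
    this, g.metricL_I_I]

include hι hm

theorem IsMomentMap.hasModelDerivAt (x : X) (ξ : EL) :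
    HasModelDerivAt ℝ (fun k : K ↦ momentL m (k • x) ξ) 1 (momentDeriv EL EK K ι g x ξ) := by
  have h1 : HasModelDerivAt ℝ (fun y : X ↦ momentL m y ξ) x
      (g.metricL x (Complex.I • actionDeriv EK EX K x (lieMapL EL EK ι ξ))) := by
    have h2 : HasModelDerivAt ℝ (fun y : X ↦ momentL m y ξ) x
        (modelDeriv ℝ EX ℝ (fun y ↦ momentL m y ξ) x) :=
      ((hm.contMDiff ξ).mdifferentiable (by simp) x).hasModelDerivAt
    have h3 : modelDeriv ℝ EX ℝ (fun y ↦ momentL m y ξ) x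
        = g.metricL x (Complex.I • actionDeriv EK EX K x (lieMapL EL EK ι ξ)) := by
      refine ContinuousLinearMap.ext fun v ↦ ?_
      refine (hm.hamiltonian ξ x v).trans ?_
      rw [hι.fundamentalVector_eq]
      rfl
    rwa [h3] at h2
  exact h1.comp (hasModelDerivAt_smul_point x) (one_smul K x)

/-- This is equivariance differentiated at 1. Exchanging ξ and η produces a sign, which is absorbed
by letting a⁻¹ act, so that Ad_a appears without an inverse. -/
theorem IsMomentMap.momentDeriv_lieMapL_eq (x : X) (ξ η : EL) :
    momentDeriv EL EK K ι g x ξ (lieMapL EL EK ι η)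
      = momentL m x (lieGroupBracket ℝ EL L η ξ) := by
  rw [momentDeriv_lieMapL]
  have h1 := (hm.hasModelDerivAt hι x η).comp (hι.hasModelDerivAt_one.comp
    (hasModelDerivAt_inv_one (E := EL) (G := L)) inv_one) (by simp)
  have h2 : HasModelDerivAt ℝ (fun a : L ↦ momentL m x (lieGroupAd ℝ EL a η)) 1
      ((momentL m x).comp (lieGroupBracket ℝ EL L η)) :=
    (hasModelDerivAt_iff_hasFDerivAt.2 (momentL m x).hasFDerivAt).comp
      (hasModelDerivAt_lieGroupAd η) rfl
  have h3 : (fun a : L ↦ momentL m (ι a⁻¹ • x) η)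
      = fun a : L ↦ momentL m x (lieGroupAd ℝ EL a η) := by
    funext a
    have := hm.equivariant a⁻¹ x η
    rw [inv_inv] at this
    exact this
  rw [h3] at h1
  have h4 := congrArg (fun f : EL →L[ℝ] ℝ ↦ f ξ) (h1.unique h2)
  simpa using h4

omit hι hm in
/-- `ζ` as a continuous linear form on the model space. -/
def dualL (ζ : Module.Dual ℝ (GroupLieAlgebra 𝓘(ℝ, EL) L)) : EL →L[ℝ] ℝ :=
  LinearMap.toContinuousLinearMap (show EL →ₗ[ℝ] ℝ from ζ)

omit hι hm in
include hζ in
theorem dualL_lieGroupBracket (ξ η : EL) : dualL ζ (lieGroupBracket ℝ EL L η ξ) = 0 := by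
  have h2 : HasModelDerivAt ℝ (fun a : L ↦ dualL ζ (lieGroupAd ℝ EL a η)) 1
      ((dualL ζ).comp (lieGroupBracket ℝ EL L η)) :=
    (hasModelDerivAt_iff_hasFDerivAt.2 (dualL ζ).hasFDerivAt).comp
      (hasModelDerivAt_lieGroupAd η) rfl
  have h3 : (fun a : L ↦ dualL ζ (lieGroupAd ℝ EL a η)) = fun _ ↦ dualL ζ η := by
    funext a
    exact hζ a η
  rw [h3] at h2
  exact congrArg (fun f : EL →L[ℝ] ℝ ↦ f ξ) (h2.unique (hasModelDerivAt_const _ _))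

end MomentMap

/-! ### The integral of α along rays and its differential. -/

section RadialPotential

variable {EL : Type*} [NormedAddCommGroup EL] [NormedSpace ℝ EL] [FiniteDimensional ℝ EL]
  {EK : Type*} [NormedAddCommGroup EK] [NormedSpace ℂ EK] [FiniteDimensional ℂ EK]
  {EX : Type*} [NormedAddCommGroup EX] [NormedSpace ℂ EX] [FiniteDimensional ℂ EX]
  {L : Type*} [Group L] [TopologicalSpace L] [ChartedSpace EL L] [LieGroup 𝓘(ℝ, EL) ∞ L] [T2Space L]
  {K : Type*} [Group K] [TopologicalSpace K] [ChartedSpace EK K] [LieGroup 𝓘(ℂ, EK) ω K]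
  {ι : L →* K} (hι : IsComplexification (EL := EL) (EK := EK) ι)
  {X : Type*} [TopologicalSpace X] [ChartedSpace EX X] [IsManifold 𝓘(ℂ, EX) ω X]
  [MulAction K X] [ContMDiffSMul 𝓘(ℂ, EK) 𝓘(ℂ, EX) ω K X]
  {g : KahlerMetric EX X} {m : X → Module.Dual ℝ (GroupLieAlgebra 𝓘(ℝ, EL) L)}
  (hm : IsMomentMap ι g m)
  {ζ : Module.Dual ℝ (GroupLieAlgebra 𝓘(ℝ, EL) L)}
  (hζ : ∀ (a : L) (ξ : GroupLieAlgebra 𝓘(ℝ, EL) L), ζ (lieAd a ξ) = ζ ξ)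

variable (EL EK) in
/-- The shifted moment map `m - ζ` at the point `e^{√-1 ξ} x`. -/
def momentPolar (ι : L →* K) (m : X → Module.Dual ℝ (GroupLieAlgebra 𝓘(ℝ, EL) L))
    (ζ : Module.Dual ℝ (GroupLieAlgebra 𝓘(ℝ, EL) L)) (x : X) (ξ : EL) : EL →L[ℝ] ℝ :=
  momentL m (polarExp EL EK ι ξ • x) - dualL ζ

variable (EL EK) in
/-- The integral of `α_{x,ζ}` along the curve `L e^{√-1 s ξ}`, `0 ≤ s ≤ 1`. -/
def radialPotential (ι : L →* K) (m : X → Module.Dual ℝ (GroupLieAlgebra 𝓘(ℝ, EL) L))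
    (ζ : Module.Dual ℝ (GroupLieAlgebra 𝓘(ℝ, EL) L)) (x : X) (ξ : EL) : ℝ :=
  ∫ s in (0 : ℝ)..1, momentPolar EL EK ι m ζ x (s • ξ) ξ

include hι

theorem IsComplexification.polarLogDeriv_smul_self (ξ : EL) (s : ℝ) :
    polarLogDeriv EL EK ι (s • ξ) ξ = Complex.I • lieMapL EL EK ι ξ := by
  have h1 := hι.hasModelDerivAt_polarExp_mul_inv (s • ξ)
  have h2 : HasModelDerivAt ℝ (fun t : ℝ ↦ t • ξ) s (ContinuousLinearMap.toSpanSingleton ℝ ξ) :=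
    hasModelDerivAt_toSpanSingleton.2 (by simpa using (hasDerivAt_id s).smul_const ξ)
  have h3 := h1.comp_deriv h2 rfl
  have h4 := congrArg (fun f : ℝ →L[ℝ] EK ↦ f 1)
    (h3.unique ((hι.isOneParameterSubgroup_polarExp ξ).hasModelDerivAt_mul_inv s))
  simpa using h4

include hm

theorem IsMomentMap.contDiff_momentPolar (x : X) : ContDiff ℝ ∞ (momentPolar EL EK ι m ζ x) := by
  refine ContDiff.sub ?_ contDiff_const
  rw [contDiff_clm_apply_iff]
  intro η
  rw [← contMDiff_iff_contDiff]
  exact (hm.contMDiff η).comp (((contMDiff_smul_point x).restrictScalars_real.of_le le_top).comp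
    hι.contMDiff_polarExp)

theorem IsMomentMap.hasFDerivAt_momentPolar_apply (x : X) (ξ η : EL) :
    HasFDerivAt (fun z ↦ momentPolar EL EK ι m ζ x z η)
      ((momentDeriv EL EK K ι g (polarExp EL EK ι ξ • x) η).comp (polarLogDeriv EL EK ι ξ)) ξ := by
  have h1 := (hm.hasModelDerivAt hι (polarExp EL EK ι ξ • x) η).comp
    (hι.hasModelDerivAt_polarExp_mul_inv ξ) (by simp)
  simp only [smul_smul, inv_mul_cancel_right] at h1
  exact (hasModelDerivAt_iff_hasFDerivAt.1 h1).sub_const (dualL ζ η)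

theorem IsMomentMap.fderiv_momentPolar_apply (x : X) (ξ η v : EL) :
    fderiv ℝ (momentPolar EL EK ι m ζ x) ξ v η
      = momentDeriv EL EK K ι g (polarExp EL EK ι ξ • x) η (polarLogDeriv EL EK ι ξ v) := by
  have h1 : HasFDerivAt (momentPolar EL EK ι m ζ x)
      (fderiv ℝ (momentPolar EL EK ι m ζ x) ξ) ξ :=
    ((hm.contDiff_momentPolar hι x).differentiable (by simp) ξ).hasFDerivAt
  have h2 := h1.clm_apply (hasFDerivAt_const η ξ)
  have h3 := congrArg (fun f : EL →L[ℝ] ℝ ↦ f v)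
    (h2.unique (hm.hasFDerivAt_momentPolar_apply (ζ := ζ) hι x ξ η))
  simpa using h3

include hζ

/-- Closedness of α in polar coordinates. Put w = D_{sξ}(sη) and y = e^{isξ}x. The product rule
gives dN(ξ) applied to Im w, plus N applied to Im Ad(e^{isξ})(iη) = η + [ξ, Re w]. By symmetry of g
the first term is d⟨m, ξ⟩(i Im w) at y, and by equivariance and invariance of ζ the bracket term is
d⟨m, ξ⟩(Re w). Together they make d⟨m, ξ⟩(w). -/
theorem IsMomentMap.hasDerivAt_momentPolar_im (x : X) (ξ η : EL) (s : ℝ) :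
    HasDerivAt (fun s : ℝ ↦ momentPolar EL EK ι m ζ x (s • ξ)
        (hι.im (polarLogDeriv EL EK ι (s • ξ) (s • η))))
      (momentDeriv EL EK K ι g (polarExp EL EK ι (s • ξ) • x) ξ
        (polarLogDeriv EL EK ι (s • ξ) (s • η)) + momentPolar EL EK ι m ζ x (s • ξ) η) s := by
  have hs : HasDerivAt (fun s : ℝ ↦ s • ξ) ξ s := by
    simpa using (hasDerivAt_id s).smul_const ξ
  have h1 := ((hm.contDiff_momentPolar (ζ := ζ) hι x).differentiable (by simp)
    (s • ξ)).hasFDerivAt.comp_hasDerivAt s hs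
  have h2 := h1.clm_apply (hι.im.hasFDerivAt.comp_hasDerivAt s
    (hι.hasDerivAt_polarLogDeriv_smul ξ η s))
  convert! h2 using 1
  simp only [Function.comp_apply]
  rw [hm.fderiv_momentPolar_apply hι, hι.polarLogDeriv_smul_self]
  set y := polarExp EL EK ι (s • ξ) • x with hy
  set w := polarLogDeriv EL EK ι (s • ξ) (s • η) with hw
  have h3 := congrArg hι.im (hι.lieGroupAd_polarExp_sub ξ η s)
  rw [map_sub, hι.im_I_smul_lieMapL, hι.im_lieGroupBracket_I, sub_eq_iff_eq_add] at h3
  rw [h3, map_add, ← add_assoc]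
  congr 1
  have h4 : momentPolar EL EK ι m ζ x (s • ξ)
      (lieGroupBracket ℝ EL L (hι.re w) ξ)
      = momentDeriv EL EK K ι g y ξ (lieMapL EL EK ι (hι.re w)) := by
    rw [hm.momentDeriv_lieMapL_eq hι, momentPolar, sub_apply, dualL_lieGroupBracket hζ, sub_zero]
  rw [h4, momentDeriv_I_lieMapL, g.metricL_symm, ← momentDeriv_I_lieMapL, add_comm, ← map_add,
    hι.re_add_im]

/-- The η-derivative of the integrand of R is exactly the total s-derivative of the preceding lemma,
so the integral reduces to boundary terms; the one at s = 0 vanishes because D_0(0) = 0. -/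
theorem IsMomentMap.hasFDerivAt_radialPotential (x : X) (ξ : EL) :
    HasFDerivAt (radialPotential EL EK ι m ζ x)
      ((momentPolar EL EK ι m ζ x ξ).comp (hι.im.comp (polarLogDeriv EL EK ι ξ))) ξ := by
  have hN := hm.contDiff_momentPolar (ζ := ζ) hι x
  have hf : ContDiff ℝ ∞ (Function.uncurry fun (ξ : EL) (s : ℝ) ↦
      momentPolar EL EK ι m ζ x (s • ξ) ξ) :=
    (hN.comp (contDiff_snd.smul contDiff_fst)).clm_apply contDiff_fst
  have h1 := hasFDerivAt_intervalIntegral_of_contDiff hf ξ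
  have hc : Continuous fun s : ℝ ↦
      fderiv ℝ (fun z ↦ momentPolar EL EK ι m ζ x (s • z) z) ξ := by
    have hq : ContDiff ℝ ∞ (Function.uncurry fun (s : ℝ) (z : EL) ↦
        momentPolar EL EK ι m ζ x (s • z) z) :=
      (hN.comp (contDiff_fst.smul contDiff_snd)).clm_apply contDiff_snd
    exact (ContDiff.fderiv (g := fun _ ↦ ξ) (n := 0) (m := ∞) hq contDiff_const
      (by simp)).continuous
  have h2 : ∀ (s : ℝ) (η : EL), fderiv ℝ (fun z ↦ momentPolar EL EK ι m ζ x (s • z) z) ξ η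
      = momentDeriv EL EK K ι g (polarExp EL EK ι (s • ξ) • x) ξ
        (polarLogDeriv EL EK ι (s • ξ) (s • η)) + momentPolar EL EK ι m ζ x (s • ξ) η := by
    intro s η
    have hs : HasFDerivAt (fun z : EL ↦ s • z) (s • ContinuousLinearMap.id ℝ EL) ξ :=
      (hasFDerivAt_id ξ).const_smul s
    have h3 := ((hN.differentiable (by simp) (s • ξ)).hasFDerivAt.comp ξ hs).clm_apply
      (hasFDerivAt_id ξ)
    refine (congrArg (fun f : EL →L[ℝ] ℝ ↦ f η) h3.fderiv).trans ?_
    have h4 := hm.fderiv_momentPolar_apply (ζ := ζ) hι x (s • ξ) ξ (s • η)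
    rw [← h4]
    simp [add_comm]
  convert! h1 using 1
  refine ContinuousLinearMap.ext fun η ↦ ?_
  rw [ContinuousLinearMap.intervalIntegral_apply (hc.intervalIntegrable _ _)]
  have h5 := intervalIntegral.integral_eq_sub_of_hasDerivAt (a := 0) (b := 1)
    (fun s _ ↦ hm.hasDerivAt_momentPolar_im hι hζ x ξ η s) (by
      simp only [← h2]
      exact (hc.clm_apply continuous_const).intervalIntegrable _ _)
  simp only [← h2] at h5
  rw [h5]
  simp

end RadialPotential

/-! ### Existence, uniqueness, cocycle rule and convexity of Φ. -/

section Potential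

variable {EL : Type*} [NormedAddCommGroup EL] [NormedSpace ℝ EL] [FiniteDimensional ℝ EL]
  {EK : Type*} [NormedAddCommGroup EK] [NormedSpace ℂ EK] [FiniteDimensional ℂ EK]
  {EX : Type*} [NormedAddCommGroup EX] [NormedSpace ℂ EX] [FiniteDimensional ℂ EX]
  {L : Type*} [Group L] [TopologicalSpace L] [ChartedSpace EL L] [LieGroup 𝓘(ℝ, EL) ∞ L] [T2Space L]
  {K : Type*} [Group K] [TopologicalSpace K] [ChartedSpace EK K] [LieGroup 𝓘(ℂ, EK) ω K]
  {ι : L →* K} (hι : IsComplexification (EL := EL) (EK := EK) ι)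
  {X : Type*} [TopologicalSpace X] [ChartedSpace EX X] [IsManifold 𝓘(ℂ, EX) ω X]
  [MulAction K X] [ContMDiffSMul 𝓘(ℂ, EK) 𝓘(ℂ, EX) ω K X]
  {g : KahlerMetric EX X} {m : X → Module.Dual ℝ (GroupLieAlgebra 𝓘(ℝ, EL) L)}
  (hm : IsMomentMap ι g m)
  {ζ : Module.Dual ℝ (GroupLieAlgebra 𝓘(ℝ, EL) L)}
  (hζ : ∀ (a : L) (ξ : GroupLieAlgebra 𝓘(ℝ, EL) L), ζ (lieAd a ξ) = ζ ξ)

omit [TopologicalSpace L] [TopologicalSpace K] [ChartedSpace EL L] [T2Space L]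
  [ChartedSpace EK K] in
theorem leftCoset_map_mul (ι : L →* K) (a : L) (k : K) :
    leftCoset ι (ι a * k) = leftCoset ι k := by
  refine Quotient.sound ?_
  change QuotientGroup.rightRel ι.range _ _
  rw [QuotientGroup.rightRel_apply]
  exact ⟨a⁻¹, by simp⟩

include hι

/-- The derivative of the polar decomposition along a curve. -/
theorem IsComplexification.exists_hasDerivAt_polarLog {k : ℝ → K} {t : ℝ} {u : EK}
    (hk : HasModelDerivAt ℝ (fun s ↦ k s * (k t)⁻¹) t (ContinuousLinearMap.toSpanSingleton ℝ u))
    {ξ : EL} (hξ : k t = polarExp EL EK ι ξ) :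
    ∃ z : EL, HasDerivAt (fun s ↦ hι.polarLog (k s)) z t ∧
      hι.im u = hι.im (polarLogDeriv EL EK ι ξ z) := by
  have hd : MDifferentiableAt 𝓘(ℝ, ℝ) 𝓘(ℝ, EK) k t := by
    have h1 := (hasModelDerivAt_mul_right (𝕜 := ℝ) (E := EK) (k t) (k t * (k t)⁻¹)).comp hk rfl
    simp only [inv_mul_cancel_right] at h1
    exact h1.mdifferentiableAt
  have ha : HasModelDerivAt ℝ (fun s ↦ hι.polarL (k s)) t
      (modelDeriv ℝ ℝ EL (fun s ↦ hι.polarL (k s)) t) :=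
    ((hι.contMDiff_polarL.mdifferentiable (by simp) _).comp t hd).hasModelDerivAt
  have hz : HasModelDerivAt ℝ (fun s ↦ hι.polarLog (k s)) t
      (modelDeriv ℝ ℝ EL (fun s ↦ hι.polarLog (k s)) t) :=
    ((hι.contMDiff_polarLog.mdifferentiable (by simp) _).comp t hd).hasModelDerivAt
  set a' := modelDeriv ℝ ℝ EL (fun s ↦ hι.polarL (k s)) t
  set z' := modelDeriv ℝ ℝ EL (fun s ↦ hι.polarLog (k s)) t
  have hat : hι.polarL (k t) = 1 := by rw [hξ, hι.polarL_polarExp]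
  have hzt : hι.polarLog (k t) = ξ := by rw [hξ, hι.polarLog_polarExp]
  have h1 := hι.hasModelDerivAt_one.comp ha hat
  have h2 := (hι.hasModelDerivAt_polarExp_mul_inv ξ).comp hz hzt
  -- The curve factors as k = ι(a) e^{iz} with a(t) = 1. Its logarithmic derivative is the sum of
  -- one in 𝔩, killed by `hι.im`, and `polarLogDeriv` applied to the velocity of z.
  have h3 := h1.mul_of_eq_one h2 (by simp [hat]) (by simp [hzt])
  have h4 := h3.congr (g := fun s ↦ k s * (k t)⁻¹) (Eventually.of_forall fun s ↦ by
    rw [← mul_assoc, hι.polar_eq, hξ])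
  have h5 := congrArg (fun f : ℝ →L[ℝ] EK ↦ f 1) (hk.unique h4)
  simp only [ContinuousLinearMap.toSpanSingleton_apply, one_smul, add_apply,
    ContinuousLinearMap.comp_apply] at h5
  refine ⟨z' 1, ?_, ?_⟩
  · exact (hasModelDerivAt_iff_hasFDerivAt.1 hz).hasDerivAt
  · rw [h5, map_add, hι.im_lieMapL, zero_add]

include hm hζ

omit hι hζ in
theorem IsMomentMap.momentL_map_smul (a : L) (x : X) (ξ : EL) :
    momentL m (ι a • x) ξ = momentL m x (lieGroupAd ℝ EL a⁻¹ ξ) :=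
  hm.equivariant a x ξ

omit hι hm in
theorem dualL_lieGroupAd (a : L) (ξ : EL) : dualL ζ (lieGroupAd ℝ EL a ξ) = dualL ζ ξ := hζ a ξ

theorem IsMomentMap.hasDerivAt_radialPotential_polarLog (x : X) (k : K) (ξ : EL) :
    HasDerivAt (fun t : ℝ ↦ radialPotential EL EK ι m ζ x
        (hι.polarLog (polarExp EL EK ι (t • ξ) * k)))
      (momentL m (k • x) ξ - dualL ζ ξ) 0 := by
  set a := hι.polarL k
  set ξ₀ := hι.polarLog k
  set ξ' := lieGroupAd ℝ EL a⁻¹ ξ with hξ'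
  have hk : ι a * polarExp EL EK ι ξ₀ = k := hι.polar_eq k
  -- With k = a e^{iξ₀}, the factor a is moved to the left by e^{itξ} a = a e^{itξ'}, ξ' = Ad(a⁻¹)ξ,
  -- and disappears in L\K. At the end, equivariance of m and invariance of ζ turn ξ' back into ξ.
  have h1 : ∀ t : ℝ, hι.polarLog (polarExp EL EK ι (t • ξ) * k)
      = hι.polarLog (polarExp EL EK ι (t • ξ') * polarExp EL EK ι ξ₀) := by
    intro t
    have h2 : polarExp EL EK ι (t • ξ) = ι a * polarExp EL EK ι (t • ξ') * (ι a)⁻¹ := by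
      rw [hι.conj_polarExp, map_smul, hξ', ← lieGroupAd_mul, mul_inv_cancel, lieGroupAd_one]
    rw [h2, ← hι.polarLog_map_mul a (polarExp EL EK ι (t • ξ') * _)]
    congr 1
    rw [← hk]; group
  have h0 := hι.isOneParameterSubgroup_polarExp ξ'
  obtain ⟨z, hz, hz'⟩ := hι.exists_hasDerivAt_polarLog
    (k := fun t : ℝ ↦ polarExp EL EK ι (t • ξ') * polarExp EL EK ι ξ₀) (t := 0)
    (u := Complex.I • lieMapL EL EK ι ξ') (ξ := ξ₀)
    ((h0.hasModelDerivAt_mul_inv 0).congr (Eventually.of_forall fun s ↦ by group))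
    (by simp [hι.polarExp_zero])
  rw [hι.im_I_smul_lieMapL] at hz'
  simp only [h1]
  have h3 := hm.hasFDerivAt_radialPotential hι hζ x ξ₀
  have h4 : ξ₀ = hι.polarLog (polarExp EL EK ι ((0 : ℝ) • ξ') * polarExp EL EK ι ξ₀) := by
    rw [zero_smul, hι.polarExp_zero, one_mul, hι.polarLog_polarExp]
  have h5 := HasFDerivAt.comp_hasDerivAt (0 : ℝ) (h4 ▸ h3) hz
  convert! h5 using 1
  simp only [ContinuousLinearMap.comp_apply]
  rw [← h4, ← hz', momentPolar, sub_apply, hξ', dualL_lieGroupAd hζ, ← hm.momentL_map_smul, smul_smul, hk]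

/-- Along the ray from L1 to Lk both sides have the same derivative, and both vanish at its start.
Stated for functions on K, this serves both the uniqueness of Φ and the cocycle rule. -/
theorem IsMomentMap.eq_radialPotential_polarLog (x : X) {f : K → ℝ}
    (hf : ∀ (a : L) (k : K), f (ι a * k) = f k) (hf1 : f 1 = 0)
    (hd : ∀ (k : K) (ξ : EL), HasDerivAt (fun t : ℝ ↦ f (polarExp EL EK ι (t • ξ) * k))
      (momentL m (k • x) ξ - dualL ζ ξ) 0) (k : K) :
    f k = radialPotential EL EK ι m ζ x (hι.polarLog k) := by
  set R := fun k : K ↦ radialPotential EL EK ι m ζ x (hι.polarLog k) with hR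
  set ξ := hι.polarLog k with hξ
  -- Since e^{itξ} = e^{i(t-s)ξ} e^{isξ}, the hypothesis at time 0 with base point e^{isξ} gives the
  -- derivative at time s.
  have hsh : ∀ (F : K → ℝ) (_ : ∀ (k : K) (ξ : EL), HasDerivAt
      (fun t : ℝ ↦ F (polarExp EL EK ι (t • ξ) * k)) (momentL m (k • x) ξ - dualL ζ ξ) 0) (s : ℝ),
      HasDerivAt (fun t : ℝ ↦ F (polarExp EL EK ι (t • ξ)))
        (momentL m (polarExp EL EK ι (s • ξ) • x) ξ - dualL ζ ξ) s := by
    intro F hF s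
    have h1 := hF (polarExp EL EK ι (s • ξ)) ξ
    rw [← sub_self s] at h1
    have h2 := h1.comp_sub_const s s
    refine h2.congr_of_eventuallyEq (Eventually.of_forall fun t ↦ ?_)
    simp only [← hι.polarExp_add_smul, sub_add_cancel]
  have h1 := hsh f hd
  have h2 := hsh R (fun k ξ ↦ hm.hasDerivAt_radialPotential_polarLog hι hζ x k ξ)
  have h3 : (fun t : ℝ ↦ f (polarExp EL EK ι (t • ξ)) - R (polarExp EL EK ι (t • ξ))) 1
      = (fun t : ℝ ↦ f (polarExp EL EK ι (t • ξ)) - R (polarExp EL EK ι (t • ξ))) 0 :=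
    is_const_of_deriv_eq_zero (fun s ↦ ((h1 s).sub (h2 s)).differentiableAt)
      (fun s ↦ ((h1 s).sub (h2 s)).deriv.trans (sub_self _)) 1 0
  simp only [one_smul, zero_smul, hι.polarExp_zero, hf1] at h3
  have h4 : R 1 = 0 := by
    have : hι.polarLog 1 = 0 := by rw [← hι.polarExp_zero, hι.polarLog_polarExp]
    simp [hR, this, radialPotential]
  rw [h4, sub_zero, sub_eq_zero] at h3
  rw [← hι.polar_eq k, hf, ← hξ, h3, hR]
  simp only [hι.polarLog_polarExp]

omit hm hι hζ in
theorem IsNormalizedPrimitive.hasDerivAt_polarExp {x : X} {Φ : LeftQuotient ι → ℝ}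
    (h : IsNormalizedPrimitive (EK := EK) ι m ζ x Φ) (k : K) (ξ : EL) :
    HasDerivAt (fun t : ℝ ↦ Φ (leftCoset ι (polarExp EL EK ι (t • ξ) * k)))
      (momentL m (k • x) ξ - dualL ζ ξ) 0 := by
  have := h.deriv_eq k ξ
  have h2 : ∀ t : ℝ, expI (EL := EL) (EK := EK) ι (t • ξ) = polarExp EL EK ι (t • ξ) :=
    fun t ↦ expI_eq ι (t • ξ)
  change HasDerivAt (fun t : ℝ ↦ Φ (leftCoset ι (expI (EL := EL) (EK := EK) ι (t • ξ) * k)))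
      (momentL m (k • x) ξ - dualL ζ ξ) 0 at this
  simpa only [h2] using this

theorem IsNormalizedPrimitive.eq_radialPotential {x : X} {Φ : LeftQuotient ι → ℝ}
    (h : IsNormalizedPrimitive (EK := EK) ι m ζ x Φ) (k : K) :
    Φ (leftCoset ι k) = radialPotential EL EK ι m ζ x (hι.polarLog k) :=
  hm.eq_radialPotential_polarLog hι hζ x (f := fun k ↦ Φ (leftCoset ι k))
    (fun a k ↦ by rw [leftCoset_map_mul]) h.normalized (fun k ξ ↦ h.hasDerivAt_polarExp k ξ) k

/-- Existence of the normalized primitive. -/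
theorem IsMomentMap.exists_isNormalizedPrimitive (x : X) :
    ∃ Φ : LeftQuotient ι → ℝ, IsNormalizedPrimitive (EK := EK) ι m ζ x Φ := by
  have hlift : ∀ a b : K, (QuotientGroup.rightRel ι.range) a b →
      radialPotential EL EK ι m ζ x (hι.polarLog a)
        = radialPotential EL EK ι m ζ x (hι.polarLog b) := by
    intro a b hab
    rw [QuotientGroup.rightRel_apply] at hab
    obtain ⟨c, hc⟩ := hab
    have : b = ι c * a := by rw [hc]; group
    rw [this, hι.polarLog_map_mul]
  refine ⟨Quotient.lift (fun k ↦ radialPotential EL EK ι m ζ x (hι.polarLog k)) hlift,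
    ?_, fun k (ξ : EL) ↦ ?_, ?_⟩
  · have h1 : MDifferentiable 𝓘(ℝ, EL) 𝓘(ℝ, ℝ) (radialPotential EL EK ι m ζ x) :=
      Differentiable.mdifferentiable fun ξ ↦
        (hm.hasFDerivAt_radialPotential hι hζ x ξ).differentiableAt
    exact h1.comp (hι.contMDiff_polarLog.mdifferentiable (by simp))
  · have h1 := hm.hasDerivAt_radialPotential_polarLog hι hζ x k ξ
    have h2 : ∀ t : ℝ, expI (EL := EL) (EK := EK) ι (t • ξ) = polarExp EL EK ι (t • ξ) :=
      fun t ↦ expI_eq ι (t • ξ)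
    simp only [← h2] at h1
    exact h1
  · have : hι.polarLog 1 = 0 := by rw [← hι.polarExp_zero, hι.polarLog_polarExp]
    change radialPotential EL EK ι m ζ x (hι.polarLog 1) = 0
    simp [this, radialPotential]

theorem IsMomentMap.existsUnique_isNormalizedPrimitive (x : X) :
    ∃! Φ : LeftQuotient ι → ℝ, IsNormalizedPrimitive (EK := EK) ι m ζ x Φ := by
  obtain ⟨Φ, hΦ⟩ := hm.exists_isNormalizedPrimitive hι hζ x
  refine ⟨Φ, hΦ, fun Ψ hΨ ↦ ?_⟩
  funext p
  induction p using Quotient.inductionOn with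
  | h k => exact (hΨ.eq_radialPotential hι hm hζ k).trans (hΦ.eq_radialPotential hι hm hζ k).symm

theorem IsMomentMap.isNormalizedPrimitive_potential (x : X) :
    IsNormalizedPrimitive (EK := EK) ι m ζ x (potential EK ι m ζ x) :=
  Classical.epsilon_spec (hm.exists_isNormalizedPrimitive hι hζ x)

/-- The cocycle property of the potentials. -/
theorem IsMomentMap.potential_mul (x : X) (h k : K) :
    potential EK ι m ζ x (leftCoset ι (h * k))
      = potential EK ι m ζ (k • x) (leftCoset ι h) + potential EK ι m ζ x (leftCoset ι k) := by
  have hP := hm.isNormalizedPrimitive_potential hι hζ x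
  have hQ := hm.isNormalizedPrimitive_potential hι hζ (k • x)
  -- The function h ↦ Φ_x(hk) - Φ_x(k) vanishes at 1 and has the derivatives prescribed by α_{kx}.
  have h1 := hm.eq_radialPotential_polarLog hι hζ (k • x)
    (f := fun h ↦ potential EK ι m ζ x (leftCoset ι (h * k)) - potential EK ι m ζ x (leftCoset ι k))
    (fun a k ↦ by rw [mul_assoc, leftCoset_map_mul]) (by simp) (fun h ξ ↦ by
      have h2 := hP.hasDerivAt_polarExp (h * k) ξ
      rw [mul_smul] at h2
      simp only [mul_assoc]
      exact h2.sub_const _) h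
  rw [hQ.eq_radialPotential hι hm hζ, ← h1, sub_add_cancel]

/-- The derivative of the potential along `t ↦ L e^{√-1 t ξ}`. -/
theorem IsMomentMap.hasDerivAt_potential (x : X) (ξ : EL) (s : ℝ) :
    HasDerivAt (fun t : ℝ ↦ potential EK ι m ζ x (leftCoset ι (polarExp EL EK ι (t • ξ))))
      (momentPolar EL EK ι m ζ x (s • ξ) ξ) s := by
  have h1 := (hm.isNormalizedPrimitive_potential hι hζ x).hasDerivAt_polarExp
    (polarExp EL EK ι (s • ξ)) ξ
  rw [← sub_self s] at h1
  have h2 := h1.comp_sub_const s s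
  refine h2.congr_of_eventuallyEq (Eventually.of_forall fun t ↦ ?_)
  simp only [← hι.polarExp_add_smul, sub_add_cancel]

omit hζ in
theorem IsMomentMap.hasDerivAt_momentPolar (x : X) (ξ : EL) (s : ℝ) :
    HasDerivAt (fun t : ℝ ↦ momentPolar EL EK ι m ζ x (t • ξ) ξ)
      (g.metricL (polarExp EL EK ι (s • ξ) • x)
        (actionDeriv EK EX K (polarExp EL EK ι (s • ξ) • x) (lieMapL EL EK ι ξ))
        (actionDeriv EK EX K (polarExp EL EK ι (s • ξ) • x) (lieMapL EL EK ι ξ))) s := by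
  have hs : HasDerivAt (fun s : ℝ ↦ s • ξ) ξ s := by
    simpa using (hasDerivAt_id s).smul_const ξ
  have h1 := (hm.hasFDerivAt_momentPolar_apply (ζ := ζ) hι x (s • ξ) ξ).comp_hasDerivAt s hs
  rwa [ContinuousLinearMap.comp_apply, hι.polarLogDeriv_smul_self, momentDeriv_I_lieMapL] at h1

theorem IsMomentMap.convexOn_potential (x : X) (ξ : EL) :
    ConvexOn ℝ univ
      (fun t : ℝ ↦ potential EK ι m ζ x (leftCoset ι (polarExp EL EK ι (t • ξ)))) := by
  refine convexOn_univ_of_deriv2_nonneg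
    (fun s ↦ (hm.hasDerivAt_potential hι hζ x ξ s).differentiableAt) ?_ ?_
  · rw [funext fun s ↦ (hm.hasDerivAt_potential hι hζ x ξ s).deriv]
    exact fun s ↦ (hm.hasDerivAt_momentPolar hι x ξ s).differentiableAt
  · intro s
    rw [Function.iterate_succ, Function.iterate_one, Function.comp_apply,
      funext fun s ↦ (hm.hasDerivAt_potential hι hζ x ξ s).deriv,
      (hm.hasDerivAt_momentPolar hι x ξ s).deriv]
    exact g.metricL_nonneg _ _

end Potential

/-! ### An Ad-invariant scalar product on 𝔩. -/

section InvariantForm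

variable {EL : Type*} [NormedAddCommGroup EL] [NormedSpace ℝ EL] [FiniteDimensional ℝ EL]
  {L : Type*} [Group L] [TopologicalSpace L] [ChartedSpace EL L] [LieGroup 𝓘(ℝ, EL) ∞ L]

theorem continuous_lieGroupAd_apply (v : EL) : Continuous fun a : L ↦ lieGroupAd ℝ EL a v := by
  have := topologicalGroup_of_lieGroup 𝓘(ℝ, EL) ∞ (G := L)
  rw [continuous_iff_continuousAt]
  intro a
  have h1 : ContinuousAt (fun b : L ↦ lieGroupAd ℝ EL b v) (a⁻¹ * a) := by
    rw [inv_mul_cancel]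
    exact (mdifferentiableAt_lieGroupAd v).continuousAt
  have h2 : ContinuousAt (fun b : L ↦ lieGroupAd ℝ EL (a⁻¹ * b) v) a :=
    ContinuousAt.comp (f := fun b ↦ a⁻¹ * b) h1 (continuous_const_mul a⁻¹).continuousAt
  have h3 : (fun b : L ↦ lieGroupAd ℝ EL b v)
      = fun b ↦ lieGroupAd ℝ EL a (lieGroupAd ℝ EL (a⁻¹ * b) v) := by
    funext b
    rw [← lieGroupAd_mul, mul_inv_cancel_left]
  rw [h3]
  exact (lieGroupAd ℝ EL a).continuous.continuousAt.comp h2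

/-- An invariant scalar product on the Lie algebra. -/
structure IsInvariantForm (L : Type*) [Group L] [TopologicalSpace L] [ChartedSpace EL L]
    (q : EL →L[ℝ] EL →L[ℝ] ℝ) : Prop where
  symm : ∀ u v, q u v = q v u
  pos : ∀ u, u ≠ 0 → 0 < q u u
  invariant : ∀ (a : L) u v, q (lieGroupAd ℝ EL a u) (lieGroupAd ℝ EL a v) = q u v

open MeasureTheory in
/-- The Lie algebra of a compact Lie group has an invariant scalar product. -/
theorem exists_isInvariantForm [T2Space L] [CompactSpace L] :
    ∃ q : EL →L[ℝ] EL →L[ℝ] ℝ, IsInvariantForm L q := by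
  have := topologicalGroup_of_lieGroup 𝓘(ℝ, EL) ∞ (G := L)
  let _ : MeasurableSpace L := borel L
  have : BorelSpace L := ⟨rfl⟩
  let μ : Measure L := Measure.haar
  let T : EL ≃L[ℝ] _ := toEuclidean (E := EL)
  -- Averaging over a⁻¹ turns Ad_b on both arguments into the left translation a ↦ b⁻¹a, matching
  -- the left invariance of Haar measure.
  let F : EL → EL → L → ℝ := fun u v a ↦
    inner ℝ (T (lieGroupAd ℝ EL a⁻¹ u)) (T (lieGroupAd ℝ EL a⁻¹ v))
  have hcont : ∀ u v, Continuous (F u v) := fun u v ↦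
    (T.continuous.comp ((continuous_lieGroupAd_apply u).comp continuous_inv)).inner
      (T.continuous.comp ((continuous_lieGroupAd_apply v).comp continuous_inv))
  have hint : ∀ u v, Integrable (F u v) μ := fun u v ↦
    (hcont u v).integrable_of_hasCompactSupport (HasCompactSupport.of_compactSpace _)
  let B : EL →ₗ[ℝ] EL →ₗ[ℝ] ℝ := LinearMap.mk₂ ℝ (fun u v ↦ ∫ a, F u v a ∂μ)
    (fun u u' v ↦ by
      rw [← integral_add (hint u v) (hint u' v)]
      simp only [F, map_add, inner_add_left])
    (fun c u v ↦ by
      rw [smul_eq_mul, ← integral_const_mul]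
      simp only [F, map_smul, inner_smul_left, RCLike.conj_to_real])
    (fun u v v' ↦ by
      rw [← integral_add (hint u v) (hint u v')]
      simp only [F, map_add, inner_add_right])
    (fun c u v ↦ by
      rw [smul_eq_mul, ← integral_const_mul]
      simp only [F, map_smul, inner_smul_right])
  let q : EL →L[ℝ] EL →L[ℝ] ℝ :=
    LinearMap.toContinuousLinearMap
      ((LinearMap.toContinuousLinearMap : (EL →ₗ[ℝ] ℝ) ≃ₗ[ℝ] (EL →L[ℝ] ℝ)).toLinearMap ∘ₗ B)
  have hq : ∀ u v, q u v = ∫ a, F u v a ∂μ := fun u v ↦ rfl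
  refine ⟨q, fun u v ↦ ?_, fun u hu ↦ ?_, fun b u v ↦ ?_⟩
  · simp only [hq, F, real_inner_comm]
  · rw [hq]
    refine (hcont u u).integral_pos_of_hasCompactSupport_nonneg_nonzero
      (HasCompactSupport.of_compactSpace _) (fun a ↦ real_inner_self_nonneg) (x := 1) ?_
    simpa [F, lieGroupAd_one] using hu
  · rw [hq, hq, ← integral_mul_left_eq_self (F u v) b⁻¹]
    simp only [F, mul_inv_rev, inv_inv, lieGroupAd_mul]

/-- Ad of e^{sξ} fixes ξ, so q(ξ, Ad(e^{sξ})η) is constant in s; its derivative at 0 is q(ξ, [ξ,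
η]). -/
theorem IsInvariantForm.apply_lieGroupBracket [T2Space L] {q : EL →L[ℝ] EL →L[ℝ] ℝ}
    (hq : IsInvariantForm L q) (ξ η : EL) : q ξ (lieGroupBracket ℝ EL L η ξ) = 0 := by
  have := FiniteDimensional.complete ℝ EL
  have h := _root_.isOneParameterSubgroup_lieExp (G := L) ξ
  have h1 := hasDerivAt_lieGroupAd (h.hasModelDerivAt_mul_inv 0) η
  have h2 := (q ξ).hasFDerivAt.comp_hasDerivAt (0 : ℝ) h1
  have h3 : (q ξ ∘ fun s : ℝ ↦ lieGroupAd ℝ EL (lieExp (E := EL) (G := L) (s • ξ : EL)) η)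
      = fun _ ↦ q ξ η := by
    funext s
    have h4 := hq.invariant (lieExp (E := EL) (G := L) (s • ξ : EL)) ξ η
    rwa [h.lieGroupAd_self s] at h4
  rw [h3] at h2
  have h5 := h2.unique (hasDerivAt_const _ _)
  rwa [h.map_zero, lieGroupAd_one] at h5

end InvariantForm

/-! ### The Gauss lemma on L\K. -/

section Gauss

variable {EL : Type*} [NormedAddCommGroup EL] [NormedSpace ℝ EL] [FiniteDimensional ℝ EL]
  {EK : Type*} [NormedAddCommGroup EK] [NormedSpace ℂ EK] [FiniteDimensional ℂ EK]
  {L : Type*} [Group L] [TopologicalSpace L] [ChartedSpace EL L] [LieGroup 𝓘(ℝ, EL) ∞ L] [T2Space L]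
  {K : Type*} [Group K] [TopologicalSpace K] [ChartedSpace EK K] [LieGroup 𝓘(ℂ, EK) ω K]
  {ι : L →* K} (hι : IsComplexification (EL := EL) (EK := EK) ι)
  {q : EL →L[ℝ] EL →L[ℝ] ℝ} (hq : IsInvariantForm L q)

include hι hq

/-- The s-derivative of the left side is q(ξ, [ξ, Re(·)]), which is zero. -/
theorem IsInvariantForm.apply_im_lieGroupAd (ξ : EL) (v : EK) (s : ℝ) :
    q ξ (hι.im (lieGroupAd ℝ EK (polarExp EL EK ι (s • ξ)) v)) = q ξ (hι.im v) := by
  have h1 := fun s ↦ ((q ξ).comp hι.im).hasFDerivAt.comp_hasDerivAt s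
    (hι.hasDerivAt_lieGroupAd_polarExp ξ v s)
  have h2 : _ = _ := is_const_of_deriv_eq_zero (fun s ↦ (h1 s).differentiableAt) (fun s ↦ by
    rw [(h1 s).deriv, ContinuousLinearMap.comp_apply, hι.im_lieGroupBracket_I,
      hq.apply_lieGroupBracket]) s 0
  simpa [hι.polarExp_zero, lieGroupAd_one] using h2

/-- By the previous lemma, q(ξ, Im D_{sξ}(sη)) has constant s-derivative q(ξ, η); integrate from 0
to 1. -/
theorem IsInvariantForm.apply_im_polarLogDeriv (ξ η : EL) :
    q ξ (hι.im (polarLogDeriv EL EK ι ξ η)) = q ξ η := by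
  have h1 := fun s ↦ (((q ξ).comp hι.im).hasFDerivAt.comp_hasDerivAt s
    (hι.hasDerivAt_polarLogDeriv_smul ξ η s)).sub ((hasDerivAt_id s).mul_const (q ξ η))
  have h2 : _ = _ := is_const_of_deriv_eq_zero (fun s ↦ (h1 s).differentiableAt) (fun s ↦ by
    rw [(h1 s).deriv, ContinuousLinearMap.comp_apply, hq.apply_im_lieGroupAd hι,
      hι.im_I_smul_lieMapL, one_mul, sub_self]) 1 0
  simpa [sub_eq_zero] using h2

/-- The Gauss lemma: the derivative of the squared distance to the base point of `L \ L^ℂ` along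
right translations. -/
theorem IsInvariantForm.hasDerivAt_polarLog_sq (ξ : EL) (v : EK) :
    HasDerivAt (fun t : ℝ ↦
      q (hι.polarLog (polarExp EL EK ι ξ * lieExp (E := EK) (G := K) (t • v : EK)))
        (hι.polarLog (polarExp EL EK ι ξ * lieExp (E := EK) (G := K) (t • v : EK))))
      (2 * q ξ (hι.im v)) 0 := by
  have h0 := hι.isOneParameterSubgroup_lieExp v
  have h00 : lieExp (E := EK) (G := K) ((0 : ℝ) • v : EK) = 1 := h0.map_zero
  obtain ⟨z, hz, hz'⟩ := hι.exists_hasDerivAt_polarLog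
    (k := fun t : ℝ ↦ polarExp EL EK ι ξ * lieExp (E := EK) (G := K) (t • v : EK)) (t := 0)
    (u := lieGroupAd ℝ EK (polarExp EL EK ι ξ) v) (ξ := ξ)
    ((h0.conj (polarExp EL EK ι ξ)).hasModelDerivAt.congr
      (Eventually.of_forall fun s ↦ by simp only [h00, mul_one]))
    (by simp only [h00, mul_one])
  have h1 := congrArg (q ξ) hz'
  have h2 := hq.apply_im_lieGroupAd hι ξ v 1
  rw [one_smul] at h2
  -- After pairing with ξ, the distortion of the polar coordinates drops out on both sides, leaving
  -- q(ξ, Im v) = q(ξ, z) for the velocity z of the logarithm.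
  rw [h2, hq.apply_im_polarLogDeriv hι] at h1
  have h3 : HasDerivAt (fun t : ℝ ↦ q (hι.polarLog (polarExp EL EK ι ξ *
      lieExp (E := EK) (G := K) (t • v : EK)))) (q z) 0 := q.hasFDerivAt.comp_hasDerivAt 0 hz
  have h4 := h3.clm_apply hz
  have h5 : hι.polarLog (polarExp EL EK ι ξ * lieExp (E := EK) (G := K) ((0 : ℝ) • v : EK)) = ξ := by
    rw [h00, mul_one, hι.polarLog_polarExp]
  rw [h5, hq.symm z ξ, ← h1, ← two_mul] at h4
  exact h4

end Gauss

/-! ### Existence of a minimum from convexity on rays. -/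

section Minimum

variable {E : Type*} [NormedAddCommGroup E] [NormedSpace ℝ E] [FiniteDimensional ℝ E]
  {q : E →L[ℝ] E →L[ℝ] ℝ}

theorem exists_pos_mul_sq_le_of_posDef (hq : ∀ u, u ≠ 0 → 0 < q u u) :
    ∃ c > 0, ∀ u, c * ‖u‖ ^ 2 ≤ q u u := by
  rcases subsingleton_or_nontrivial E with hE | hE
  · exact ⟨1, one_pos, fun u ↦ by simp [Subsingleton.elim u 0]⟩
  have hc : Continuous fun u : E ↦ q u u := by fun_prop
  have := FiniteDimensional.proper_real E
  obtain ⟨p, hp, hmin⟩ := (isCompact_sphere (0 : E) 1).exists_isMinOn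
    (NormedSpace.sphere_nonempty.2 zero_le_one) hc.continuousOn
  have hp0 : p ≠ 0 := by
    rintro rfl
    simp at hp
  refine ⟨q p p, hq p hp0, fun u ↦ ?_⟩
  rcases eq_or_ne u 0 with rfl | hu
  · simp
  have hu' : 0 < ‖u‖ := norm_pos_iff.2 hu
  have h1 := hmin (show ‖u‖⁻¹ • u ∈ Metric.sphere (0 : E) 1 by
    simp [norm_smul, hu'.ne'])
  simp only [mem_ofPred_eq, map_smul, smul_apply, smul_eq_mul] at h1
  calc q p p * ‖u‖ ^ 2 ≤ (‖u‖⁻¹ * (‖u‖⁻¹ * q u u)) * ‖u‖ ^ 2 := by gcongr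
    _ = q u u := by field_simp

/-- A function which is convex along rays attains its minimum, provided that it tends to infinity
along the rays outside of a set which is orthogonal to the shortest vectors in the level sets. -/
theorem exists_forall_le_of_convexOn_rays (hq : ∀ u, u ≠ 0 → 0 < q u u) {φ : E → ℝ}
    (hφ : Continuous φ) (hφ0 : φ 0 = 0) (hconv : ∀ ξ, ConvexOn ℝ univ fun t : ℝ ↦ φ (t • ξ))
    {V : Set E} (htend : ∀ ξ, ξ ∉ V → Tendsto (fun t : ℝ ↦ φ (t • ξ)) atTop atTop)
    (horth : ∀ ξ, (∀ η, φ η = φ ξ → q ξ ξ ≤ q η η) → ∀ b ∈ V, q ξ b = 0) :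
    ∃ ξ₀, ∀ ξ, φ ξ₀ ≤ φ ξ := by
  have := FiniteDimensional.proper_real E
  by_contra! hno
  obtain ⟨c, hc, hcq⟩ := exists_pos_mul_sq_le_of_posDef hq
  have hqc : Continuous fun u : E ↦ q u u := by fun_prop
  have hcomp : ∀ r : ℝ, IsCompact {u : E | q u u ≤ r} := by
    intro r
    refine Metric.isCompact_of_isClosed_isBounded (isClosed_le hqc continuous_const) ?_
    refine (Metric.isBounded_iff_subset_closedBall 0).2 ⟨√(r / c), fun u hu ↦ ?_⟩
    rw [mem_closedBall_zero_iff]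
    refine Real.le_sqrt_of_sq_le ?_
    rw [le_div_iff₀ hc, mul_comm]
    exact (hcq u).trans hu
  -- The minimizer over the ball is chosen shortest among minimizers. It is then shortest in its
  -- whole level set, since points outside the ball are longer anyway.
  have hex : ∀ n : ℕ, ∃ ξ : E, (∀ η, q η η ≤ n → φ ξ ≤ φ η) ∧
      ∀ η, φ η = φ ξ → q ξ ξ ≤ q η η := by
    intro n
    obtain ⟨p, hp, hpmin⟩ := (hcomp n).exists_isMinOn ⟨0, by simp⟩ hφ.continuousOn
    obtain ⟨ξ, hξ, hξmin⟩ := ((hcomp n).inter_right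
      (isClosed_eq hφ (continuous_const (y := φ p)))).exists_isMinOn ⟨p, hp, rfl⟩ hqc.continuousOn
    have hξp : φ ξ = φ p := hξ.2
    refine ⟨ξ, fun η hη ↦ hξp.trans_le (hpmin hη), fun η hη ↦ ?_⟩
    by_contra! hlt
    have hξn : q ξ ξ ≤ n := hξ.1
    exact absurd (hξmin (show η ∈ {u : E | q u u ≤ n} ∩ {x | φ x = φ p} from
      ⟨hlt.le.trans hξn, hη.trans hξp⟩)) (not_le.2 hlt)
  choose ξ hξmin hξlev using hex
  -- Without a global minimum, some η lies strictly below the minimum p over the ball of radius R;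
  -- as soon as the n-th ball contains η, the point ξ_n must lie outside radius R.
  have hnorm : Tendsto (fun n ↦ ‖ξ n‖) atTop atTop := by
    refine tendsto_atTop.2 fun R ↦ ?_
    obtain ⟨p, -, hpmin⟩ := (isCompact_closedBall (0 : E) (max R 0)).exists_isMinOn
      (Metric.nonempty_closedBall.2 (le_max_right _ _)) hφ.continuousOn
    obtain ⟨η, hη⟩ := hno p
    filter_upwards [tendsto_natCast_atTop_atTop.eventually_ge_atTop (q η η)] with n hn
    by_contra! hlt
    have h1 : φ p ≤ φ (ξ n) := hpmin (mem_closedBall_zero_iff.2 (hlt.le.trans (le_max_left _ _)))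
    exact absurd (h1.trans (hξmin n η hn)) (not_le.2 hη)
  have hle : ∀ n, φ (ξ n) ≤ 0 := fun n ↦ hφ0 ▸ hξmin n 0 (by simp)
  obtain ⟨u, -, σ, hσ, hu⟩ := (isCompact_closedBall (0 : E) 1).tendsto_subseq
    (x := fun n ↦ ‖ξ n‖⁻¹ • ξ n) (fun n ↦ by
      rw [mem_closedBall_zero_iff, norm_smul, norm_inv, norm_norm]
      exact inv_mul_le_one)
  have hnσ : Tendsto (fun n ↦ ‖ξ (σ n)‖) atTop atTop := hnorm.comp hσ.tendsto_atTop
  have hu1 : ‖u‖ = 1 := by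
    refine tendsto_nhds_unique hu.norm (tendsto_const_nhds.congr' ?_)
    filter_upwards [hnσ.eventually_gt_atTop 0] with n hn
    simp [norm_smul, hn.ne']
  -- Convexity on the segment from 0 to ξ_n, with φ ≤ 0 at both ends, bounds φ at its point of norm
  -- t once ‖ξ_n‖ ≥ t; then pass to the limit.
  have hray : ∀ t : ℝ, 0 ≤ t → φ (t • u) ≤ 0 := by
    intro t ht
    refine le_of_tendsto ((hφ.tendsto _).comp (hu.const_smul t)) ?_
    filter_upwards [hnσ.eventually_gt_atTop 0, hnσ.eventually_ge_atTop t] with n hn hnt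
    simp only [Function.comp_apply, smul_smul]
    have h1 : t * ‖ξ (σ n)‖⁻¹ ≤ 1 := by
      rw [← div_eq_mul_inv]
      exact (div_le_one hn).2 hnt
    have h2 := (hconv (ξ (σ n))).2 (mem_univ (0 : ℝ)) (mem_univ (1 : ℝ))
      (sub_nonneg.2 h1) (show 0 ≤ t * ‖ξ (σ n)‖⁻¹ by positivity) (by ring)
    simp only [zero_add, smul_eq_mul, mul_one, zero_smul, hφ0, mul_zero, one_smul] at h2
    exact h2.trans (mul_nonpos_of_nonneg_of_nonpos (by positivity) (hle _))
  -- If u ∈ V, orthogonality of every ξ_n to u survives in the limit as q(u, u) = 0; if not, φ tends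
  -- to infinity along the ray of u, where it is bounded by 0.
  by_cases huV : u ∈ V
  · have h1 : Tendsto (fun n ↦ q (‖ξ (σ n)‖⁻¹ • ξ (σ n)) u) atTop (𝓝 (q u u)) :=
      ((continuous_id.clm_apply continuous_const).comp q.continuous).continuousAt.tendsto.comp hu
    have h2 : ∀ n, q (‖ξ (σ n)‖⁻¹ • ξ (σ n)) u = 0 := fun n ↦ by
      simp [horth _ (hξlev (σ n)) u huV]
    simp only [h2] at h1
    have h3 := tendsto_nhds_unique h1 tendsto_const_nhds
    have hu0 : u ≠ 0 := by
      rintro rfl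
      simp at hu1
    exact absurd h3 (hq u hu0).ne'
  · obtain ⟨t, ht0, ht⟩ := ((eventually_ge_atTop 0).and
      ((htend u huV).eventually_gt_atTop 0)).exists
    exact absurd (hray t ht0) (not_le.2 ht)

end Minimum

/-! ### Critical points, stabilizers and growth. -/

section Critical

variable {EL : Type*} [NormedAddCommGroup EL] [NormedSpace ℝ EL] [FiniteDimensional ℝ EL]
  {EK : Type*} [NormedAddCommGroup EK] [NormedSpace ℂ EK] [FiniteDimensional ℂ EK]
  {EX : Type*} [NormedAddCommGroup EX] [NormedSpace ℂ EX] [FiniteDimensional ℂ EX]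
  {L : Type*} [Group L] [TopologicalSpace L] [ChartedSpace EL L] [LieGroup 𝓘(ℝ, EL) ∞ L] [T2Space L]
  {K : Type*} [Group K] [TopologicalSpace K] [ChartedSpace EK K] [LieGroup 𝓘(ℂ, EK) ω K]
  {ι : L →* K} (hι : IsComplexification (EL := EL) (EK := EK) ι)
  {X : Type*} [TopologicalSpace X] [T2Space X] [ChartedSpace EX X] [IsManifold 𝓘(ℂ, EX) ω X]
  [MulAction K X] [ContMDiffSMul 𝓘(ℂ, EK) 𝓘(ℂ, EX) ω K X]
  {g : KahlerMetric EX X} {m : X → Module.Dual ℝ (GroupLieAlgebra 𝓘(ℝ, EL) L)}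
  (hm : IsMomentMap ι g m)
  {ζ : Module.Dual ℝ (GroupLieAlgebra 𝓘(ℝ, EL) L)}
  (hζ : ∀ (a : L) (ξ : GroupLieAlgebra 𝓘(ℝ, EL) L), ζ (lieAd a ξ) = ζ ξ)

/-- A curve in a manifold with vanishing velocity is constant. -/
theorem eq_of_hasModelDerivAt_zero {c : ℝ → X}
    (hc : ∀ t, HasModelDerivAt ℝ c t (0 : ℝ →L[ℝ] EX)) (s t : ℝ) : c s = c t := by
  have : IsManifold 𝓘(ℝ, EX) 1 X := IsManifold.of_le (n := ω) le_top
  have := FiniteDimensional.complete ℂ EX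
  have h0 : ContMDiff 𝓘(ℝ, EX) 𝓘(ℝ, EX).tangent 1
      (fun x : X ↦ (⟨x, 0⟩ : TangentBundle 𝓘(ℝ, EX) X)) := by
    have : IsManifold 𝓘(ℝ, EX) (1 + 1) X := IsManifold.of_le (n := ω) le_top
    exact Bundle.contMDiff_zeroSection ℝ (TangentSpace 𝓘(ℝ, EX) : X → Type _)
  have h1 : IsMIntegralCurve (I := 𝓘(ℝ, EX)) c (fun _ ↦ 0) := fun t ↦
    (isMIntegralCurve_iff_hasModelDerivAt (E := EX) (X := fun _ ↦ 0)).2 (by simpa using hc t)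
  have h2 : IsMIntegralCurve (I := 𝓘(ℝ, EX)) (fun _ ↦ c t) (fun _ : X ↦ 0) :=
    isMIntegralCurve_const rfl
  exact congrFun (isMIntegralCurve_Ioo_eq_of_contMDiff_boundaryless (t₀ := t) h0 h1 h2 rfl) s

include hι

/-- The orbit curve has zero velocity at time 0, and acting by e^{sv} transports this to every time
s; a curve with zero velocity is constant. -/
theorem IsComplexification.lieExp_smul_eq_of_actionDeriv_eq_zero {y : X} {v : EK}
    (hv : actionDeriv EK EX K y v = 0) (t : ℝ) :
    lieExp (E := EK) (G := K) (t • v : EK) • y = y := by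
  have h0 := hι.isOneParameterSubgroup_lieExp v
  have h00 : lieExp (E := EK) (G := K) ((0 : ℝ) • v : EK) = 1 := h0.map_zero
  have h1 : HasModelDerivAt ℝ (fun t : ℝ ↦ lieExp (E := EK) (G := K) (t • v : EK) • y) 0
      (0 : ℝ →L[ℝ] EX) := by
    have h2 := (hasModelDerivAt_smul_point (EK := EK) (EX := EX) y).comp_deriv
      h0.hasModelDerivAt h0.map_zero
    simpa [hv] using h2
  have h2 : ∀ s : ℝ, HasModelDerivAt ℝ (fun t : ℝ ↦ lieExp (E := EK) (G := K) (t • v : EK) • y) s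
      (0 : ℝ →L[ℝ] EX) := by
    intro s
    set k := lieExp (E := EK) (G := K) (s • v : EK) with hk
    have h3 : HasModelDerivAt ℝ (fun z : X ↦ k • z) y (modelDeriv ℝ EX EX (fun z : X ↦ k • z) y) :=
      ((contMDiff_const_smul_real (EK := EK) k).mdifferentiable (by simp) y).hasModelDerivAt
    have h4 := h3.comp h1 (by rw [h00, one_smul])
    rw [ContinuousLinearMap.comp_zero] at h4
    have h5 : HasModelDerivAt ℝ (fun t : ℝ ↦ t + -s) s
        (ContinuousLinearMap.toSpanSingleton ℝ (1 : ℝ)) :=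
      hasModelDerivAt_toSpanSingleton.2 ((hasDerivAt_id s).add_const (-s))
    have h6 := h4.comp h5 (by simp)
    rw [ContinuousLinearMap.zero_comp] at h6
    refine h6.congr (Eventually.of_forall fun r ↦ ?_)
    have h7 : lieExp (E := EK) (G := K) ((s + (r + -s)) • v : EK)
      = k * lieExp (E := EK) (G := K) ((r + -s) • v : EK) := h0.1 s (r + -s)
    rw [smul_smul, ← h7]
    congr 3
    ring
  have h3 := eq_of_hasModelDerivAt_zero h2 t 0
  simpa only [h00, one_smul] using h3

include hm

theorem IsMomentMap.monotone_momentPolar (x : X) (ξ : EL) :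
    Monotone fun t : ℝ ↦ momentPolar EL EK ι m ζ x (t • ξ) ξ :=
  monotone_of_deriv_nonneg (fun s ↦ (hm.hasDerivAt_momentPolar hι x ξ s).differentiableAt)
    fun s ↦ by
      rw [(hm.hasDerivAt_momentPolar hι x ξ s).deriv]
      exact g.metricL_nonneg _ _

include hζ

/-- A convex function lies above its tangent: the slope is monotone, so Φ minus the tangent line at
s increases on [s, ∞). -/
theorem IsMomentMap.le_potential_polarExp (x : X) (ξ : EL) {s t : ℝ} (hst : s ≤ t) :
    potential EK ι m ζ x (leftCoset ι (polarExp EL EK ι (s • ξ)))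
        + momentPolar EL EK ι m ζ x (s • ξ) ξ * (t - s)
      ≤ potential EK ι m ζ x (leftCoset ι (polarExp EL EK ι (t • ξ))) := by
  set c := momentPolar EL EK ι m ζ x (s • ξ) ξ
  have hd := fun r : ℝ ↦ (hm.hasDerivAt_potential hι hζ x ξ r).sub ((hasDerivAt_id r).const_mul c)
  have h1 := monotoneOn_of_deriv_nonneg (convex_Ici s)
    (fun r _ ↦ (hd r).continuousAt.continuousWithinAt)
    (fun r _ ↦ (hd r).differentiableAt.differentiableWithinAt) (fun r hr ↦ by
      rw [(hd r).deriv, mul_one, sub_nonneg]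
      rw [interior_Ici] at hr
      exact hm.monotone_momentPolar hι x ξ (le_of_lt hr)) (mem_Ici.2 le_rfl) (mem_Ici.2 hst) hst
  simp only [Pi.sub_apply, id] at h1
  linarith

omit hm hζ in
theorem momentPolar_zero (x : X) (ξ : EL) :
    momentPolar EL EK ι m ζ x ((0 : ℝ) • ξ) ξ = momentL m x ξ - dualL ζ ξ := by
  simp [momentPolar, hι.polarExp_zero]

theorem IsMomentMap.potential_nonneg {y : X} (hy : ∀ ξ : EL, momentL m y ξ = dualL ζ ξ) (k : K) :
    0 ≤ potential EK ι m ζ y (leftCoset ι k) := by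
  have h1 := hm.le_potential_polarExp hι hζ y (hι.polarLog k) zero_le_one
  rw [momentPolar_zero hι, hy, sub_self, zero_mul, add_zero, zero_smul, hι.polarExp_zero, one_smul,
    (hm.isNormalizedPrimitive_potential hι hζ y).normalized] at h1
  rwa [← hι.polar_eq k, leftCoset_map_mul]

/-- By the cocycle rule Φ_y(γ) + Φ_y(γ⁻¹) = Φ_y(1) = 0 with both terms nonnegative, so Φ_y(γ) = 0;
the rule for hγ then gives the claim. -/
theorem IsMomentMap.potential_mul_stabilizer {y : X} (hy : ∀ ξ : EL, momentL m y ξ = dualL ζ ξ)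
    {γ : K} (hγ : γ ∈ MulAction.stabilizer K y) (h : K) :
    potential EK ι m ζ y (leftCoset ι (h * γ)) = potential EK ι m ζ y (leftCoset ι h) := by
  have hγ' : γ • y = y := hγ
  have h1 := hm.potential_mul hι hζ y γ⁻¹ γ
  rw [inv_mul_cancel, (hm.isNormalizedPrimitive_potential hι hζ y).normalized, hγ'] at h1
  have h2 := hm.potential_nonneg hι hζ hy γ
  have h3 := hm.potential_nonneg hι hζ hy γ⁻¹
  rw [hm.potential_mul hι hζ, hγ']
  linarith

theorem IsMomentMap.tendsto_potential {y : X} (hy : ∀ ξ : EL, momentL m y ξ = dualL ζ ξ)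
    {ξ : EL} (hξ : ξ ∉ stabIm EL EK ι y) :
    Tendsto (fun t : ℝ ↦ potential EK ι m ζ y (leftCoset ι (polarExp EL EK ι (t • ξ))))
      atTop atTop := by
  have hact : actionDeriv EK EX K y (lieMapL EL EK ι ξ) ≠ 0 := by
    intro h0
    -- By complex linearity of the infinitesimal action, ξ* = 0 at y makes iξ itself fix y, so a = 0
    -- serves as the real part.
    refine hξ ⟨(0 : EL), fun t ↦ ?_⟩
    have h1 : actionDeriv EK EX K y (complexLieL EL EK ι (0, ξ)) = 0 := by
      rw [complexLieL_apply, map_zero, zero_add, map_smul, h0, smul_zero]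
    exact hι.lieExp_smul_eq_of_actionDeriv_eq_zero h1 t
  set G := fun t : ℝ ↦ momentPolar EL EK ι m ζ y (t • ξ) ξ with hG
  have hG0 : G 0 = 0 := by rw [hG]; simp only [momentPolar_zero hι, hy, sub_self]
  have hmono : Monotone G := hm.monotone_momentPolar hι y ξ
  -- Otherwise the monotone slope G is identically 0 on [0, 1], and its one-sided derivative at 0
  -- would be 0 rather than |ξ*|² > 0.
  have hG1 : 0 < G 1 := by
    by_contra! hle
    have h1 := hm.hasDerivAt_momentPolar (ζ := ζ) hι y ξ 0
    have h2 : HasDerivWithinAt G 0 (Icc 0 1) 0 := by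
      refine (hasDerivWithinAt_const (0 : ℝ) (Icc 0 1) (0 : ℝ)).congr (fun s hs ↦ ?_) hG0
      exact le_antisymm ((hmono hs.2).trans hle) (hG0 ▸ hmono hs.1)
    have h3 := (uniqueDiffOn_Icc zero_lt_one 0 (left_mem_Icc.2 zero_le_one)).eq_deriv _
      h1.hasDerivWithinAt h2
    rw [zero_smul, hι.polarExp_zero, one_smul] at h3
    exact absurd h3 (g.metricL_pos y hact).ne'
  -- The tangent line at t = 1, of positive slope G 1, is a lower bound.
  refine tendsto_atTop_mono' atTop ((eventually_ge_atTop 1).mono fun t ht ↦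
    hm.le_potential_polarExp hι hζ y ξ ht) ?_
  exact tendsto_atTop_add_const_left _ _
    ((tendsto_atTop_add_const_right _ (-1) tendsto_id).const_mul_atTop hG1)

theorem IsMomentMap.momentL_eq_of_critical {x : X} {k : K}
    (hk : HasMFDerivAt 𝓘(ℝ, EK) 𝓘(ℝ, ℝ) (fun h : K ↦ potential EK ι m ζ x (leftCoset ι h)) k
      (0 : EK →L[ℝ] ℝ)) (ξ : EL) : momentL m (k • x) ξ = dualL ζ ξ := by
  have h1 := (hm.isNormalizedPrimitive_potential hι hζ x).hasDerivAt_polarExp k ξ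
  have h2 := (hasModelDerivAt_mul_right (𝕜 := ℝ) (E := EK) k 1).comp_deriv
    (hι.isOneParameterSubgroup_polarExp ξ).hasModelDerivAt
    (hι.isOneParameterSubgroup_polarExp ξ).map_zero
  have hk' : HasModelDerivAt ℝ (fun h : K ↦ potential EK ι m ζ x (leftCoset ι h)) k
      (0 : EK →L[ℝ] ℝ) := hk
  have h3 := hk'.comp_deriv h2 (by simp [hι.polarExp_zero])
  rw [hasModelDerivAt_toSpanSingleton] at h3
  have h4 := h1.unique h3
  simpa [sub_eq_zero] using h4

theorem IsMomentMap.exists_forall_radialPotential_le [CompactSpace L] {y : X}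
    (hinv : ∀ γ ∈ MulAction.stabilizer K y, ∀ h : K,
      potential EK ι m ζ y (leftCoset ι (h * γ)) = potential EK ι m ζ y (leftCoset ι h))
    (htend : ∀ ξ : EL, ξ ∉ stabIm EL EK ι y →
      Tendsto (fun t : ℝ ↦ potential EK ι m ζ y (leftCoset ι (polarExp EL EK ι (t • ξ))))
        atTop atTop) :
    ∃ ξ₀ : EL, ∀ ξ, radialPotential EL EK ι m ζ y ξ₀ ≤ radialPotential EL EK ι m ζ y ξ := by
  obtain ⟨q, hq⟩ := exists_isInvariantForm (EL := EL) (L := L)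
  have hP : ∀ k, potential EK ι m ζ y (leftCoset ι k)
      = radialPotential EL EK ι m ζ y (hι.polarLog k) := fun k ↦
    (hm.isNormalizedPrimitive_potential hι hζ y).eq_radialPotential hι hm hζ k
  have hP' : ∀ ξ, radialPotential EL EK ι m ζ y ξ
      = potential EK ι m ζ y (leftCoset ι (polarExp EL EK ι ξ)) := fun ξ ↦ by
    rw [hP, hι.polarLog_polarExp]
  refine exists_forall_le_of_convexOn_rays (V := stabIm EL EK ι y) hq.pos
    (continuous_iff_continuousAt.2 fun ξ ↦
      (hm.hasFDerivAt_radialPotential hι hζ y ξ).continuousAt) (by simp [radialPotential])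
    (fun ξ ↦ ?_) (fun ξ hξ ↦ ?_) (fun ξ hξ b hb ↦ ?_)
  · simp only [hP']
    exact hm.convexOn_potential hι hζ y ξ
  · simp only [hP']
    exact htend ξ hξ
  · obtain ⟨a, ha⟩ := hb
    have h1 := hq.hasDerivAt_polarLog_sq hι ξ (complexLieL EL EK ι (a, b))
    have h2 : hι.im (complexLieL EL EK ι (a, b)) = b := hι.im_apply a b
    have h00 : lieExp (E := EK) (G := K) ((0 : ℝ) • complexLieL EL EK ι (a, b) : EK) = 1 :=
      (hι.isOneParameterSubgroup_lieExp (complexLieL EL EK ι (a, b))).map_zero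
    -- Right translation by the stabilizer preserves the level set of ξ, in which ξ is shortest, so
    -- the squared length is minimal at t = 0. By the Gauss lemma its derivative there is 2 q(ξ, b).
    have hmin : IsLocalMin (fun t : ℝ ↦
        q (hι.polarLog (polarExp EL EK ι ξ *
            lieExp (E := EK) (G := K) (t • complexLieL EL EK ι (a, b) : EK)))
          (hι.polarLog (polarExp EL EK ι ξ *
            lieExp (E := EK) (G := K) (t • complexLieL EL EK ι (a, b) : EK)))) 0 := by
      refine Eventually.of_forall fun t ↦ ?_
      simp only [h00, mul_one, hι.polarLog_polarExp]
      refine hξ _ ?_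
      rw [← hP, hP' ξ]
      exact hinv _ (ha t) _
    have h3 := hmin.hasDerivAt_eq_zero h1
    rw [h2] at h3
    linarith

theorem IsMomentMap.hasCriticalPoint_of_forall_le {x : X} {k : K} {ξ₀ : EL}
    (hmin : ∀ ξ, radialPotential EL EK ι m ζ (k • x) ξ₀ ≤ radialPotential EL EK ι m ζ (k • x) ξ) :
    HasCriticalPoint (EK := EK) ι (potential EK ι m ζ x) := by
  have h1 := hm.hasFDerivAt_radialPotential hι hζ (k • x) ξ₀
  have h2 : IsLocalMin (radialPotential EL EK ι m ζ (k • x)) ξ₀ := Eventually.of_forall hmin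
  rw [h2.hasFDerivAt_eq_zero h1] at h1
  have h3 : HasModelDerivAt ℝ (fun h : K ↦ hι.polarLog (h * k⁻¹)) (polarExp EL EK ι ξ₀ * k)
      (modelDeriv ℝ EK EL (fun h : K ↦ hι.polarLog (h * k⁻¹)) (polarExp EL EK ι ξ₀ * k)) :=
    ((hι.contMDiff_polarLog.comp (contMDiff_mul_right (I := 𝓘(ℝ, EK)) (n := ∞)
      (a := k⁻¹))).mdifferentiable (by simp) _).hasModelDerivAt
  -- By the cocycle rule Φ_x(h) = Φ_{kx}(hk⁻¹) + Φ_x(k), so the minimum at e^{iξ₀} for kx becomes a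
  -- critical point of Φ_x at e^{iξ₀}k.
  have h4 := (hasModelDerivAt_iff_hasFDerivAt.2
    (h1.add_const (potential EK ι m ζ x (leftCoset ι k)))).comp h3
    (by rw [mul_inv_cancel_right, hι.polarLog_polarExp])
  rw [ContinuousLinearMap.zero_comp] at h4
  refine ⟨polarExp EL EK ι ξ₀ * k, h4.congr (Eventually.of_forall fun h ↦ ?_)⟩
  have h5 := hm.potential_mul hι hζ x (h * k⁻¹) k
  rw [inv_mul_cancel_right] at h5
  rw [h5, (hm.isNormalizedPrimitive_potential hι hζ (k • x)).eq_radialPotential hι hm hζ]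

end Critical

end

theorem proposition4p8
    {EL : Type*} [NormedAddCommGroup EL] [NormedSpace ℝ EL] [FiniteDimensional ℝ EL]
    {EK : Type*} [NormedAddCommGroup EK] [NormedSpace ℂ EK] [FiniteDimensional ℂ EK]
    {EX : Type*} [NormedAddCommGroup EX] [NormedSpace ℂ EX] [FiniteDimensional ℂ EX]
    -- the compact connected Lie group `L`
    {L : Type*} [Group L] [TopologicalSpace L] [ChartedSpace EL L] [LieGroup 𝓘(ℝ, EL) ∞ L]
    [T2Space L] [CompactSpace L] [ConnectedSpace L]
    -- its complexification `K = L^ℂ`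
    {K : Type*} [Group K] [TopologicalSpace K] [ChartedSpace EK K] [LieGroup 𝓘(ℂ, EK) ω K]
    (ι : L →* K) (hι : IsComplexification (EL := EL) (EK := EK) ι)
    -- the complex manifold `X` with the holomorphic action of `L^ℂ`
    {X : Type*} [TopologicalSpace X] [T2Space X] [ChartedSpace EX X] [IsManifold 𝓘(ℂ, EX) ω X]
    [MulAction K X] [ContMDiffSMul 𝓘(ℂ, EK) 𝓘(ℂ, EX) ω K X]
    -- the Kähler metric, preserved by `L`, and the moment map
    (g : KahlerMetric EX X) (hg : ActsIsometrically ι g)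
    (m : X → Module.Dual ℝ (GroupLieAlgebra 𝓘(ℝ, EL) L)) (hm : IsMomentMap ι g m)
    -- `ζ` is fixed by the coadjoint action
    (ζ : Module.Dual ℝ (GroupLieAlgebra 𝓘(ℝ, EL) L))
    (hζ : ∀ (a : L) (ξ : GroupLieAlgebra 𝓘(ℝ, EL) L), ζ (lieAd a ξ) = ζ ξ)
    (x : X) :
    (∃! Φ : LeftQuotient ι → ℝ, IsNormalizedPrimitive (EK := EK) ι m ζ x Φ) ∧
    (HasCriticalPoint (EK := EK) ι (potential EK ι m ζ x) ↔
      ∃ k : K,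
        (∀ γ ∈ MulAction.stabilizer K (k • x), ∀ h : K,
          potential EK ι m ζ (k • x) (leftCoset ι (h * γ)) =
            potential EK ι m ζ (k • x) (leftCoset ι h)) ∧
        (∀ ξ : GroupLieAlgebra 𝓘(ℝ, EL) L, ξ ∉ stabIm EL EK ι (k • x) →
          Tendsto (fun t : ℝ ↦ potential EK ι m ζ (k • x) (leftCoset ι (expI (EK := EK) ι (t • ξ))))
            atTop atTop)) := by
  refine ⟨hm.existsUnique_isNormalizedPrimitive hι hζ x, ?_, ?_⟩
  · rintro ⟨k, hk⟩
    have hy := hm.momentL_eq_of_critical hι hζ hk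
    refine ⟨k, fun γ hγ h ↦ hm.potential_mul_stabilizer hι hζ hy hγ h, fun (ξ : EL) hξ ↦ ?_⟩
    have h1 := hm.tendsto_potential hι hζ hy hξ
    have h2 : ∀ t : ℝ, expI (EL := EL) (EK := EK) ι (t • ξ) = polarExp EL EK ι (t • ξ) :=
      fun t ↦ expI_eq ι (t • ξ)
    simp only [← h2] at h1
    exact h1
  · rintro ⟨k, hinv, htend⟩
    obtain ⟨ξ₀, hξ₀⟩ := hm.exists_forall_radialPotential_le hι hζ hinv fun (ξ : EL) hξ ↦ by
      have h1 := htend ξ hξ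
      have h2 : ∀ t : ℝ, expI (EL := EL) (EK := EK) ι (t • ξ) = polarExp EL EK ι (t • ξ) :=
        fun t ↦ expI_eq ι (t • ξ)
      change Tendsto (fun t : ℝ ↦ potential EK ι m ζ (k • x)
        (leftCoset ι (expI (EL := EL) (EK := EK) ι (t • ξ)))) atTop atTop at h1
      simpa only [h2] using h1
    exact hm.hasCriticalPoint_of_forall_le hι hζ hξ₀
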